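/- Let $N\ge 2$, let the data universe be $\mathcal X=\{0,\dots,N-1\}$, and put $d=\lceil\log_2 N\rceil$. For a dataset $D\in\mathcal X^n$ let $f(D)$ be its mode (the most frequent element, ties being broken towards the smallest element), let $\mathrm{occ}_1$ be the number of occurrences of $f(D)$, and let $\mathrm{occ}_2$ be the largest number of occurrences of an element other than $f(D)$. Fix $\bot\in\mathcal X$, and write $\mathrm{Lap}(b)$ for the Laplace distribution with density $\frac1{2b}e^{-|x|/b}$. The pure-DP mode-release algorithm with parameter $\varepsilon>0$ does the following on input $D$. 1. Let $\delta$ be given by $\log(1/\delta)=d\log(2d^3/\varepsilon)$. Draw $Z\sim\mathrm{Lap}(1/\varepsilon)$. If $\lceil(\mathrm{occ}_1-\mathrm{occ}_2)/2\rceil-1+Z\le\log(1/\delta)/\varepsilon$, set $u_{\mathrm{apx}}=\bot$; otherwise set $u_{\mathrm{apx}}=f(D)$. 2. Let $z\in\{0,1\}^d$ be the binary representation of $u_{\mathrm{apx}}$, let $\omega=2^{-d}$ and $\Delta=2d\,(\delta/(2\omega))^{1/d}$. With probability $1-\omega$ let $x=z$; otherwise draw $x$ uniformly from $[0,1]^d$.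 Add independent $\mathrm{Lap}(2\Delta/\varepsilon)$ noise to each coordinate of $x$, and round each coordinate to $1$ if it is at least $1/2$ and to $0$ otherwise. Return the element of $\mathcal X$ with this binary representation (or $\bot$ if the number represented is not less than $N$). Then the following hold. (a) For all $N\ge2$, $n$, $\bot$ and $\varepsilon>0$ the algorithm is $2\varepsilon$-differentially private: for all $D,D'\in\mathcal X^n$ that differ in at most one entry and every $S\subseteq\mathcal X$, the output $\mathcal M$ satisfies $\mathbb P[\mathcal M(D)\in S]\le e^{2\varepsilon}\,\mathbb P[\mathcal M(D')\in S]$. (b) It runs in time $\mathcal O(n+\log|\mathcal X|)$: there are a single program for a unit-cost randomized random access machine (with zero-initialized memory; natural-number registers with addition, truncated subtraction, halving and comparison; real registers with arithmetic, $\exp$, $\log$ and comparison; and drawing of a uniform or a Laplace random number) and an absolute constant $C$ such that for all $N\ge2$, $n$, $\bot$, $\varepsilon>0$ and $D\in\mathcal X^n$ the program always halts after at most $C(n+\log|\mathcal X|)$ steps, and its output has exactly the distribution of the output of the algorithm. (c) There is an absolute constant $K$ such that for all $\varepsilon_0>0$ and $c>1$ there is a constant $C$, depending only on $\varepsilon_0$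 and $c$, with the following property. For all $N\ge 2$, $n$, $\bot$, $D\in\mathcal X^n$ and $0<\varepsilon\le\varepsilon_0$ with $\log|\mathcal X|\ge c\,\varepsilon$, if $$\mathrm{occ}_1-\mathrm{occ}_2> C\,\frac{\log|\mathcal X|\,\log(\log|\mathcal X|/\varepsilon)}{\varepsilon},$$ then the algorithm returns the mode $f(D)$ with probability at least $1-K/|\mathcal X|$. (For instance, one constant $C$ serves all $\varepsilon\le1$ and $|\mathcal X|\ge3$.) -/

import Mathlib

open MeasureTheory ProbabilityTheory
open scoped ENNReal

namespace ModeRelease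

/-! ### Differential privacy -/

/-- A mechanism `M` maps a dataset of `n` records to the law `M D` of its random output.  It is
`(ε, δ)`-differentially private if for all datasets differing in at most one entry and every event
`S`, `P[M D ∈ S] ≤ exp ε * P[M D' ∈ S] + δ`. -/
def IsDP {n : ℕ} {X Y : Type*} [DecidableEq X] [MeasurableSpace Y] (ε δ : ℝ)
    (M : (Fin n → X) → Measure Y) : Prop :=
  (∀ D, IsProbabilityMeasure (M D)) ∧
    ∀ D D' : Fin n → X, hammingDist D D' ≤ 1 → ∀ S : Set Y, MeasurableSet S →
      M D S ≤ ENNReal.ofReal (Real.exp ε) * M D' S + ENNReal.ofReal δ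

/-! ### Laplace noise and purification on `ℝ^d` -/

/-- The centred Laplace distribution with scale `b`. -/
noncomputable def laplace (b : ℝ) : Measure ℝ :=
  volume.withDensity fun x => ENNReal.ofReal (Real.exp (-|x| / b) / (2 * b))

/-- `Δ = 2 d^(1 - 1/q) R (δ / (2ω))^(1/d)`. -/
noncomputable def purifyDelta (d : ℕ) (q : ℝ≥0∞) (R δ ω : ℝ) : ℝ :=
  2 * (d : ℝ) ^ (1 - (1 / q).toReal) * R * (δ / (2 * ω)) ^ (1 / (d : ℝ))

/-- The law of `x + Laplace^{⊗d}(2Δ/ε')`, where `x` has law `μ` with probability `1 - ω` and is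
uniform on `Θ` with probability `ω`.  Here `Θ` is an `ℓ_q` ball of diameter `R`. -/
noncomputable def purify {d : ℕ} (μ : Measure (Fin d → ℝ)) (Θ : Set (Fin d → ℝ)) (q : ℝ≥0∞)
    (R ε' δ ω : ℝ) : Measure (Fin d → ℝ) :=
  (ENNReal.ofReal (1 - ω) • μ + ENNReal.ofReal ω • cond volume Θ) ∗
    Measure.pi fun _ : Fin d => laplace (2 * purifyDelta d q R δ ω / ε')

/-! ### Purification on the finite space `{0, …, N - 1}` through the binary embedding -/

/-- The number of bits, `⌈log₂ N⌉`. -/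
def bits (N : ℕ) : ℕ := Nat.clog 2 N

/-- The binary representation of `u` as a vertex of the cube (least significant bit first). -/
def binMap {N : ℕ} (u : Fin N) : Fin (bits N) → ℝ :=
  fun i => if (u : ℕ).testBit i then 1 else 0

/-- Coordinatewise rounding to `{0, 1}^d`, at the threshold `1/2`. -/
noncomputable def roundCube {d : ℕ} (z : Fin d → ℝ) : Fin d → Bool :=
  fun i => decide (1 / 2 ≤ z i)

/-- Decoding of a binary word; the words that are not in the range of `binMap`, which exist only
if `N` is not a power of two, are decoded as `bot`. -/
def decode {N : ℕ} (bot : Fin N) (w : Fin (bits N) → Bool) : Fin N :=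
  if h : Nat.ofBits w < N then ⟨Nat.ofBits w, h⟩ else bot

/-- Binary embedding purification of an output with law `μ`.  The cube `[0, 1]^d` is the `ℓ_∞` ball
of diameter `1`; the mixture level is `2^{-d}`. -/
noncomputable def purifyDiscrete {N : ℕ} (ε δ : ℝ) (bot : Fin N) (μ : Measure (Fin N)) :
    Measure (Fin N) :=
  (purify (μ.map binMap) (Set.Icc 0 1) ∞ 1 ε δ ((2 : ℝ)⁻¹ ^ bits N)).map
    fun z => decode bot (roundCube z)

/-! ### Mode release -/

/-- The number of occurrences of `x` in `D`. -/
def freq {n N : ℕ} (D : Fin n → Fin N) (x : Fin N) : ℕ :=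
  (Finset.univ.filter fun i => D i = x).card

/-- The most frequent elements of `D`. -/
def modes {n N : ℕ} (D : Fin n → Fin N) : Finset (Fin N) :=
  Finset.univ.filter fun x => ∀ y, freq D y ≤ freq D x

theorem modes_nonempty {n N : ℕ} [NeZero N] (D : Fin n → Fin N) : (modes D).Nonempty := by
  obtain ⟨x, -, hx⟩ := Finset.exists_max_image Finset.univ (freq D) ⟨0, Finset.mem_univ _⟩
  exact ⟨x, by simpa [modes] using hx⟩

/-- The mode of `D`, ties being broken towards the smallest element. -/
def mode {n N : ℕ} [NeZero N] (D : Fin n → Fin N) : Fin N :=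
  (modes D).min' (modes_nonempty D)

/-- The frequency of the most frequent item. -/
def occ₁ {n N : ℕ} [NeZero N] (D : Fin n → Fin N) : ℕ := freq D (mode D)

/-- The frequency of the second most frequent item, i.e. the largest frequency of an item other
than the mode. -/
def occ₂ {n N : ℕ} [NeZero N] (D : Fin n → Fin N) : ℕ :=
  (Finset.univ.erase (mode D)).sup (freq D)

/-- `log (1/δ) = d log (2 d³ / ε)` with `d = ⌈log₂ N⌉`. -/
noncomputable def logInvDelta (N : ℕ) (ε : ℝ) : ℝ :=
  bits N * Real.log (2 * (bits N : ℝ) ^ 3 / ε)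

/-- The distance to instability `⌈(occ₁ - occ₂) / 2⌉`. -/
noncomputable def instabilityDist {n N : ℕ} [NeZero N] (D : Fin n → Fin N) : ℤ :=
  ⌈((occ₁ D : ℝ) - occ₂ D) / 2⌉

/-- The law of the output of the distance-to-instability test; the failure symbol `⊥` is
represented by a fixed element `bot` of the universe. -/
noncomputable def approxMode {n N : ℕ} [NeZero N] (ε : ℝ) (bot : Fin N) (D : Fin n → Fin N) :
    Measure (Fin N) :=
  (laplace (1 / ε)).map fun z =>
    if (instabilityDist D : ℝ) - 1 + z ≤ logInvDelta N ε / ε then bot else mode D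

/-- The law of the output of the pure DP mode release algorithm. -/
noncomputable def modeRelease {n N : ℕ} [NeZero N] (ε : ℝ) (bot : Fin N) (D : Fin n → Fin N) :
    Measure (Fin N) :=
  purifyDiscrete ε (Real.exp (-logInvDelta N ε)) bot (approxMode ε bot D)

/-! ### Running time: a randomized random access machine with unit costs

The machine has registers and a memory for natural numbers, the memory being addressed indirectly
through the registers, and registers for real numbers.  Every instruction, including the drawing of
one uniform or one Laplace random number, costs one step. -/

/-- The instructions; `i`, `j`, `k` are numbers of registers and `l` is a program line. -/
inductive Instr where
  /-- natural registers: `rᵢ := c` -/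
  | const (i c : ℕ)
  /-- `rᵢ := rⱼ + rₖ` -/
  | add (i j k : ℕ)
  /-- `rᵢ := max (rⱼ - rₖ) 0` -/
  | sub (i j k : ℕ)
  /-- `rᵢ := ⌊rⱼ / 2⌋` -/
  | half (i j : ℕ)
  /-- `rᵢ := mem[rⱼ]` -/
  | load (i j : ℕ)
  /-- `mem[rᵢ] := rⱼ` -/
  | store (i j : ℕ)
  /-- the real register `xᵢ := rⱼ` -/
  | cast (i j : ℕ)
  /-- `xᵢ := xⱼ + xₖ` -/
  | addR (i j k : ℕ)
  /-- `xᵢ := xⱼ - xₖ` -/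
  | subR (i j k : ℕ)
  /-- `xᵢ := xⱼ * xₖ` -/
  | mulR (i j k : ℕ)
  /-- `xᵢ := xⱼ / xₖ` -/
  | divR (i j k : ℕ)
  /-- `xᵢ := exp xⱼ` -/
  | expR (i j : ℕ)
  /-- `xᵢ := log xⱼ` -/
  | logR (i j : ℕ)
  /-- `xᵢ :=` a fresh random number, uniform on `[0, 1]` -/
  | drawUnif (i : ℕ)
  /-- `xᵢ :=` a fresh random number with the Laplace distribution of scale `1` -/
  | drawLap (i : ℕ)
  /-- go to line `l` -/
  | jump (l : ℕ)
  /-- go to line `l` if `rᵢ ≤ rⱼ` -/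
  | jumpLE (i j l : ℕ)
  /-- go to line `l` if `xᵢ ≤ xⱼ` -/
  | jumpLER (i j l : ℕ)

/-- A configuration of the machine; `draws` counts the entries of the random tape already read. -/
structure Config where
  pc : ℕ
  reg : ℕ → ℕ
  mem : ℕ → ℕ
  xreg : ℕ → ℝ
  draws : ℕ

/-- A random tape: each entry holds a uniform and a Laplace random number. -/
abbrev Tape : Type := ℕ → ℝ × ℝ

/-- The law of the tape: all the numbers on it are independent. -/
noncomputable def tapeLaw : Measure Tape :=
  Measure.infinitePi fun _ : ℕ => (volume.restrict (Set.Icc (0 : ℝ) 1)).prod (laplace 1)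

namespace Config

/-- Proceed to the next line. -/
def next (s : Config) : Config := { s with pc := s.pc + 1 }

/-- Assign a natural register. -/
def setReg (s : Config) (i v : ℕ) : Config := { s with reg := Function.update s.reg i v }

/-- Assign a real register. -/
noncomputable def setX (s : Config) (i : ℕ) (v : ℝ) : Config :=
  { s with xreg := Function.update s.xreg i v }

end Config

/-- The effect of one instruction. -/
noncomputable def Instr.exec (τ : Tape) (s : Config) : Instr → Config
  | .const i c => (s.setReg i c).next
  | .add i j k => (s.setReg i (s.reg j + s.reg k)).next
  | .sub i j k => (s.setReg i (s.reg j - s.reg k)).next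
  | .half i j => (s.setReg i (s.reg j / 2)).next
  | .load i j => (s.setReg i (s.mem (s.reg j))).next
  | .store i j => { s with mem := Function.update s.mem (s.reg i) (s.reg j) }.next
  | .cast i j => (s.setX i (s.reg j)).next
  | .addR i j k => (s.setX i (s.xreg j + s.xreg k)).next
  | .subR i j k => (s.setX i (s.xreg j - s.xreg k)).next
  | .mulR i j k => (s.setX i (s.xreg j * s.xreg k)).next
  | .divR i j k => (s.setX i (s.xreg j / s.xreg k)).next
  | .expR i j => (s.setX i (Real.exp (s.xreg j))).next
  | .logR i j => (s.setX i (Real.log (s.xreg j))).next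
  | .drawUnif i => { s.setX i (τ s.draws).1 with draws := s.draws + 1 }.next
  | .drawLap i => { s.setX i (τ s.draws).2 with draws := s.draws + 1 }.next
  | .jump l => { s with pc := l }
  | .jumpLE i j l => if s.reg i ≤ s.reg j then { s with pc := l } else s.next
  | .jumpLER i j l => if s.xreg i ≤ s.xreg j then { s with pc := l } else s.next

/-- A program is a finite list of instructions; the machine has halted when the program counter
points beyond it. -/
def Halted (P : List Instr) (s : Config) : Prop := P.length ≤ s.pc

/-- One step of the machine; a halted machine does not move. -/
noncomputable def step (P : List Instr) (τ : Tape) (s : Config) : Config :=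
  match P[s.pc]? with
  | some I => I.exec τ s
  | none => s

/-- The configuration after `t` steps. -/
noncomputable def run (P : List Instr) (τ : Tape) (s : Config) (t : ℕ) : Config :=
  (step P τ)^[t] s

/-- The input configuration: `n`, `N`, `bot` in the first three registers, `ε` in the first real
register, the `n` records in the first `n` memory cells, and zeros elsewhere. -/
noncomputable def input {n N : ℕ} (ε : ℝ) (bot : Fin N) (D : Fin n → Fin N) : Config where
  pc := 0
  reg i := if i = 0 then n else if i = 1 then N else if i = 2 then (bot : ℕ) else 0
  mem i := if h : i < n then (D ⟨i, h⟩ : ℕ) else 0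
  xreg i := if i = 0 then ε else 0
  draws := 0

/-- Within `T` steps, whatever the random tape, the program `P` halts on the given input, and the
content of its first register is then distributed according to `μ`. -/
def ComputesWithin {n N : ℕ} (P : List Instr) (ε : ℝ) (bot : Fin N) (D : Fin n → Fin N) (T : ℕ)
    (μ : Measure (Fin N)) : Prop :=
  (∀ τ, Halted P (run P τ (input ε bot D) T)) ∧
    tapeLaw.map (fun τ => (run P τ (input ε bot D) T).reg 0) = μ.map fun x : Fin N => (x : ℕ)

end ModeRelease

/-!
Let `h x` be the probability that the output lies in `S` when the noise is added to the point `x` of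
the cube. Laplace noise makes `log h` Lipschitz for the `ℓ¹` distance. If neighbouring datasets have
the same mode, the statistic of the stability test moves by at most one, which costs a factor `e^ε`.
If their modes differ, both are within distance one of instability, so that each passes its test
with probability at most `δ / 2`. When the cube of side `s = (δ / (2ω))^(1/d)` fits into the unit
cube, this mass can be moved from the vertex of the mode to the vertex of `⊥` along a chain of small
cubes of side about `s`, each passing an equal mass of the uniform part on to the next: every step
is short, so this costs only `e^(ε/2)`, and going from one dataset to the other through `⊥` costs
`e^ε`. When `s > 1`, the noise is so large that it hides the whole cube.

The output differs from a mode with a large margin only if the test fails, the uniform point is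
drawn, or some coordinate of the noise exceeds `1/2`; each of these has probability `O(1/N)`.

For the machine, each random draw consumes its own entry of an independent tape; hence a loop that
stores its `i`-th draw as the `i`-th coordinate of the noise produces the product law.
-/

namespace ModeRelease

/-! ### The Laplace distribution -/

instance (b : ℝ) : SigmaFinite (laplace b) := by unfold laplace; infer_instance

theorem laplace_Ioi {b t : ℝ} (hb : 0 < b) (ht : 0 ≤ t) :
    laplace b (Set.Ioi t) = ENNReal.ofReal (Real.exp (-t / b) / 2) := by
  have hneg : -(1 / b) < 0 := by simpa using hb
  have hdensity : ∫⁻ x in Set.Ioi t, ENNReal.ofReal (Real.exp (-|x| / b) / (2 * b)) =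
      ∫⁻ x in Set.Ioi t, ENNReal.ofReal (Real.exp (-(1 / b) * x) / (2 * b)) := by
    refine setLIntegral_congr_fun measurableSet_Ioi fun x hx => ?_
    rw [abs_of_nonneg (ht.trans (le_of_lt hx)), show -x / b = -(1 / b) * x by ring]
  rw [laplace, withDensity_apply _ measurableSet_Ioi, hdensity,
    ← ofReal_integral_eq_lintegral_ofReal]
  · rw [integral_div, integral_exp_mul_Ioi hneg, show -(1 / b) * t = -t / b by ring]
    field_simp
  · exact (integrableOn_exp_mul_Ioi hneg t).div_const _
  · exact Filter.Eventually.of_forall fun x => by positivity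

theorem laplace_Iic {b t : ℝ} (hb : 0 < b) (ht : t ≤ 0) :
    laplace b (Set.Iic t) = ENNReal.ofReal (Real.exp (t / b) / 2) := by
  have hpos : 0 < 1 / b := by positivity
  have hdensity : ∫⁻ x in Set.Iic t, ENNReal.ofReal (Real.exp (-|x| / b) / (2 * b)) =
      ∫⁻ x in Set.Iic t, ENNReal.ofReal (Real.exp (1 / b * x) / (2 * b)) := by
    refine setLIntegral_congr_fun measurableSet_Iic fun x hx => ?_
    rw [abs_of_nonpos (le_trans hx ht), show - -x / b = 1 / b * x by ring]
  rw [laplace, withDensity_apply _ measurableSet_Iic, hdensity,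
    ← ofReal_integral_eq_lintegral_ofReal]
  · rw [integral_div, integral_exp_mul_Iic hpos, show 1 / b * t = t / b by ring]
    field_simp
  · exact (integrableOn_exp_mul_Iic hpos t).div_const _
  · exact Filter.Eventually.of_forall fun x => by positivity

theorem isProbabilityMeasure_laplace {b : ℝ} (hb : 0 < b) : IsProbabilityMeasure (laplace b) := by
  constructor
  rw [← Set.Iic_union_Ioi (a := (0 : ℝ)), measure_union (by simp) measurableSet_Ioi,
    laplace_Iic hb le_rfl, laplace_Ioi hb le_rfl,
    ← ENNReal.ofReal_add (by positivity) (by positivity)]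
  norm_num

theorem laplace_eq_map_mul {b : ℝ} (hb : 0 < b) :
    laplace b = (laplace 1).map fun x => b * x := by
  have := isProbabilityMeasure_laplace hb
  have := isProbabilityMeasure_laplace one_pos
  have hm : Measurable fun x : ℝ => b * x := by fun_prop
  have := Measure.isProbabilityMeasure_map (μ := laplace 1) hm.aemeasurable
  refine Measure.ext_of_Iic _ _ fun t => ?_
  have hpre : (fun x : ℝ => b * x) ⁻¹' Set.Iic t = Set.Iic (t / b) := by
    ext x; simp [le_div_iff₀ hb, mul_comm]
  rw [Measure.map_apply hm measurableSet_Iic, hpre]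
  rcases le_total t 0 with ht | ht
  · rw [laplace_Iic hb ht, laplace_Iic one_pos (div_nonpos_of_nonpos_of_nonneg ht hb.le), div_one]
  · rw [← Set.compl_Ioi, ← Set.compl_Ioi, prob_compl_eq_one_sub measurableSet_Ioi,
      prob_compl_eq_one_sub measurableSet_Ioi, laplace_Ioi hb ht,
      laplace_Ioi one_pos (div_nonneg ht hb.le), div_one, neg_div]

theorem map_add_left_laplace (b x : ℝ) :
    (laplace b).map (fun z => x + z) =
      volume.withDensity fun y => ENNReal.ofReal (Real.exp (-|y - x| / b) / (2 * b)) := by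
  have hm : Measurable fun z : ℝ => x + z := by fun_prop
  ext A hA
  rw [Measure.map_apply hm hA, laplace, withDensity_apply _ (hm hA), withDensity_apply _ hA,
    ← lintegral_indicator (hm hA), ← lintegral_indicator hA,
    ← lintegral_add_left_eq_self (A.indicator _) x]
  refine lintegral_congr fun z => ?_
  by_cases hz : x + z ∈ A <;> simp [hz]

theorem map_add_left_laplace_le {b : ℝ} (hb : 0 < b) (x y : ℝ) :
    (laplace b).map (fun z => x + z) ≤
      ENNReal.ofReal (Real.exp (|x - y| / b)) • (laplace b).map (fun z => y + z) := by
  rw [map_add_left_laplace, map_add_left_laplace, ← withDensity_smul _ (by fun_prop)]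
  refine withDensity_mono (Filter.Eventually.of_forall fun z => ?_)
  rw [Pi.smul_apply, smul_eq_mul, ← ENNReal.ofReal_mul (by positivity), ← mul_div_assoc,
    ← Real.exp_add, ← add_div]
  beta_reduce
  gcongr
  have := abs_sub_le z x y
  linarith

/-! ### Product noise -/

section ProductNoise

variable {ι : Type*} [Fintype ι]

theorem pi_mono {α : ι → Type*} [∀ i, MeasurableSpace (α i)] {μ ν : ∀ i, Measure (α i)}
    [∀ i, SigmaFinite (μ i)] (h : ∀ i, μ i ≤ ν i) : Measure.pi μ ≤ Measure.pi ν := by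
  have houter : (Measure.pi μ).toOuterMeasure ≤ OuterMeasure.pi fun i => (ν i).toOuterMeasure := by
    refine OuterMeasure.le_pi.2 fun s _ => ?_
    calc Measure.pi μ (Set.univ.pi s) = ∏ i, μ i (s i) := Measure.pi_pi μ s
      _ ≤ ∏ i, ν i (s i) := Finset.prod_le_prod' fun i _ => h i (s i)
  refine Measure.le_iff.2 fun A hA => ?_
  rw [Measure.pi_def ν, toMeasure_apply _ _ hA]
  exact houter A

theorem pi_const_smul {α : ι → Type*} [∀ i, MeasurableSpace (α i)] (c : ι → ℝ≥0∞)
    (hc : ∀ i, c i ≠ ∞) (μ : ∀ i, Measure (α i)) [∀ i, IsFiniteMeasure (μ i)] :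
    Measure.pi (fun i => c i • μ i) = (∏ i, c i) • Measure.pi μ := by
  have := fun i => (μ i).smul_finite (hc i)
  refine Measure.pi_eq fun s _ => ?_
  simp [Finset.prod_mul_distrib]

/-- `log h` is `1 / b`-Lipschitz for the `ℓ₁` norm.  This is how the law of any event depends on the
point to which independent Laplace noise of scale `b` is added. -/
def LogLipschitz (b : ℝ) (h : (ι → ℝ) → ℝ≥0∞) : Prop :=
  ∀ x y, h x ≤ ENNReal.ofReal (Real.exp ((∑ i, |x i - y i|) / b)) * h y

/-- The probability that `x` falls into `A` after adding independent Laplace noise of scale `b` to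
its coordinates. -/
noncomputable def noisyProb (b : ℝ) (A : Set (ι → ℝ)) (x : ι → ℝ) : ℝ≥0∞ :=
  Measure.pi (fun _ => laplace b) ((fun z => x + z) ⁻¹' A)

theorem measurable_noisyProb (b : ℝ) {A : Set (ι → ℝ)} (hA : MeasurableSet A) :
    Measurable (noisyProb b A) :=
  measurable_measure_prodMk_left (hA.preimage (measurable_fst.add measurable_snd))

theorem logLipschitz_noisyProb {b : ℝ} (hb : 0 < b) {A : Set (ι → ℝ)} (hA : MeasurableSet A) :
    LogLipschitz b (noisyProb b A) := by
  intro x y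
  have := isProbabilityMeasure_laplace hb
  have hshift (x : ι → ℝ) : (Measure.pi fun _ => laplace b).map (fun z => x + z) =
      Measure.pi fun i => (laplace b).map fun z => x i + z :=
    Measure.pi_map_pi fun i => (measurable_const_add (x i)).aemeasurable
  have hle : (Measure.pi fun _ => laplace b).map (fun z => x + z) ≤
      ENNReal.ofReal (Real.exp ((∑ i, |x i - y i|) / b)) •
        (Measure.pi fun _ => laplace b).map (fun z => y + z) := by
    rw [hshift, hshift, Finset.sum_div, Real.exp_sum,
      ENNReal.ofReal_prod_of_nonneg fun i _ => (Real.exp_pos _).le,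
      ← pi_const_smul _ fun i => ENNReal.ofReal_ne_top]
    exact pi_mono fun i => map_add_left_laplace_le hb (x i) (y i)
  simpa only [noisyProb, Measure.smul_apply, smul_eq_mul,
    Measure.map_apply (measurable_const_add _) hA] using hle A

theorem LogLipschitz.le_of_forall_abs_sub_le {b c : ℝ} {h : (ι → ℝ) → ℝ≥0∞} {x y : ι → ℝ}
    (hh : LogLipschitz b h) (hb : 0 < b) (hxy : ∀ i, |x i - y i| ≤ c) :
    h x ≤ ENNReal.ofReal (Real.exp (Fintype.card ι * c / b)) * h y := by
  have hsum : ∑ i, |x i - y i| ≤ Fintype.card ι * c := by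
    simpa using Finset.sum_le_card_nsmul Finset.univ _ c fun i _ => hxy i
  refine (hh x y).trans ?_
  gcongr

theorem LogLipschitz.lintegral_le_of_ae_mem_Icc {b : ℝ} {h : (ι → ℝ) → ℝ≥0∞}
    (hh : LogLipschitz b h) (hb : 0 < b) {μ ν : Measure (ι → ℝ)} [IsProbabilityMeasure μ]
    [IsProbabilityMeasure ν] (hμ : ∀ᵐ x ∂μ, x ∈ Set.Icc 0 1) (hν : ∀ᵐ x ∂ν, x ∈ Set.Icc 0 1) :
    ∫⁻ x, h x ∂μ ≤ ENNReal.ofReal (Real.exp (Fintype.card ι / b)) * ∫⁻ x, h x ∂ν := by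
  have hcube {x y : ι → ℝ} (hx : x ∈ Set.Icc 0 1) (hy : y ∈ Set.Icc 0 1) :
      h x ≤ ENNReal.ofReal (Real.exp (Fintype.card ι / b)) * h y := by
    rw [← mul_one (Fintype.card ι : ℝ)]
    refine hh.le_of_forall_abs_sub_le hb fun i => ?_
    simpa using abs_sub_le_of_le_of_le (hx.1 i) (hx.2 i) (hy.1 i) (hy.2 i)
  have hpoint : ∀ᵐ x ∂μ, h x ≤ ENNReal.ofReal (Real.exp (Fintype.card ι / b)) * ∫⁻ y, h y ∂ν := by
    filter_upwards [hμ] with x hx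
    calc h x = ∫⁻ _, h x ∂ν := by simp
      _ ≤ ∫⁻ y, ENNReal.ofReal (Real.exp (Fintype.card ι / b)) * h y ∂ν :=
        lintegral_mono_ae (hν.mono fun y hy => hcube hx hy)
      _ = _ := lintegral_const_mul' _ _ ENNReal.ofReal_ne_top
  simpa using lintegral_mono_ae hpoint

end ProductNoise

/-! ### Transport of a small mass along a chain of cubes -/

section Chain

variable {ι : Type*} {k : ℕ} {m v : ι → ℝ}

/-- The `j`-th of `k` cubes of side `1 / k` along the diagonal from `m` to `v`.  For `m` and `v` in
the unit cube all of them lie in the unit cube, and the first and the last one touch `m` and `v`. -/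
def chainCube (k : ℕ) (m v : ι → ℝ) (j : ℕ) : Set (ι → ℝ) :=
  Set.univ.pi fun i =>
    Set.Ico ((1 - (j + 1) / k) * m i + j / k * v i) ((1 - (j + 1) / k) * m i + j / k * v i + 1 / k)

theorem measurableSet_chainCube [Countable ι] (k : ℕ) (m v : ι → ℝ) (j : ℕ) :
    MeasurableSet (chainCube k m v j) :=
  MeasurableSet.univ_pi fun _ => measurableSet_Ico

theorem chainCube_subset_Icc (hm : m ∈ Set.Icc 0 1) (hv : v ∈ Set.Icc 0 1) {j : ℕ} (hj : j < k) :
    chainCube k m v j ⊆ Set.Icc 0 1 := by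
  have hk : (0 : ℝ) < k := by exact_mod_cast (Nat.zero_le j).trans_lt hj
  have hlast : ((j : ℝ) + 1) / k ≤ 1 := by
    rw [div_le_one hk]; exact_mod_cast hj
  have hjk : (0 : ℝ) ≤ j / k := by positivity
  have hcorner (i : ι) : 0 ≤ (1 - (j + 1) / k) * m i + j / k * v i ∧
      (1 - (j + 1) / k) * m i + j / k * v i ≤ 1 - 1 / k := by
    have hm0 : 0 ≤ (1 - (j + 1) / k) * m i := mul_nonneg (by linarith) (hm.1 i)
    have hm1 : (1 - (j + 1) / k) * m i ≤ 1 - (j + 1) / k :=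
      mul_le_of_le_one_right (by linarith) (hm.2 i)
    have hv0 : 0 ≤ j / k * v i := mul_nonneg hjk (hv.1 i)
    have hv1 : j / k * v i ≤ j / k := mul_le_of_le_one_right hjk (hv.2 i)
    have := add_div (j : ℝ) 1 k
    constructor <;> linarith
  intro x hx
  refine ⟨fun i => ?_, fun i => ?_⟩
  · exact (hcorner i).1.trans (hx i trivial).1
  · have := (hx i trivial).2
    have := (hcorner i).2
    simp only [Pi.one_apply]
    linarith

theorem disjoint_chainCube {i : ι} (hi : |m i - v i| = 1) (hk : 0 < k) {j l : ℕ} (hjl : j ≠ l) :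
    Disjoint (chainCube k m v j) (chainCube k m v l) := by
  wlog hlt : j < l generalizing j l
  · exact (this hjl.symm (by omega)).symm
  have hstep : (j : ℝ) / k + 1 / k ≤ l / k := by
    rw [← add_div]
    gcongr
    exact_mod_cast hlt
  refine Set.disjoint_left.2 fun x hxj hxl => ?_
  have hj := hxj i trivial
  have hl := hxl i trivial
  simp only [add_div, Set.mem_Ico] at hj hl
  rcases eq_or_eq_neg_of_abs_eq hi with h | h
  · rw [show m i = v i + 1 by linarith] at hj hl
    linarith [hj.1, hl.2]
  · rw [show m i = v i - 1 by linarith] at hj hl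
    linarith [hj.2, hl.1]

theorem add_mem_chainCube_succ {x : ι → ℝ} {j : ℕ} :
    x + (fun i => 1 / k * (v i - m i)) ∈ chainCube k m v (j + 1) ↔ x ∈ chainCube k m v j := by
  simp only [chainCube, Set.mem_univ_pi, Set.mem_Ico, Pi.add_apply]
  refine forall_congr' fun i => ?_
  push_cast
  simp only [add_div]
  constructor <;> rintro ⟨hlow, hhigh⟩ <;> constructor <;> linarith

theorem chainCube_last (hk : 0 < k) : chainCube k m v (k - 1) = chainCube k v m 0 := by
  have hk' : (k : ℝ) ≠ 0 := by exact_mod_cast hk.ne'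
  simp [chainCube, Nat.cast_pred hk, sub_div, hk']

theorem abs_sub_le_of_mem_chainCube_zero (hm : m ∈ Set.Icc 0 1) {x : ι → ℝ}
    (hx : x ∈ chainCube k m v 0) (i : ι) : |x i - m i| ≤ 1 / k := by
  have hk : (0 : ℝ) ≤ 1 / k := by positivity
  have hi := hx i trivial
  simp only [Nat.cast_zero, zero_add, zero_div, zero_mul, add_zero, Set.mem_Ico] at hi
  have hm0 : 0 ≤ 1 / k * m i := mul_nonneg hk (hm.1 i)
  have hm1 : 1 / k * m i ≤ 1 / k := mul_le_of_le_one_right hk (hm.2 i)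
  rw [abs_le]
  constructor <;> linarith

variable [Fintype ι] {b : ℝ} {h : (ι → ℝ) → ℝ≥0∞}

theorem volume_chainCube (k : ℕ) (m v : ι → ℝ) (j : ℕ) :
    volume (chainCube k m v j) = ENNReal.ofReal ((1 / k) ^ Fintype.card ι) := by
  rw [chainCube, Real.volume_pi_Ico, ENNReal.ofReal_pow (by positivity)]
  simp

theorem LogLipschitz.setLIntegral_chainCube_le_succ (hh : LogLipschitz b h) (hb : 0 < b)
    (hm : m ∈ Set.Icc 0 1) (hv : v ∈ Set.Icc 0 1) (j : ℕ) :
    ∫⁻ x in chainCube k m v j, h x ≤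
      ENNReal.ofReal (Real.exp (Fintype.card ι * (1 / k) / b)) *
        ∫⁻ x in chainCube k m v (j + 1), h x := by
  set u : ι → ℝ := fun i => 1 / k * (v i - m i) with hu
  have hshift : ∫⁻ x in chainCube k m v (j + 1), h x = ∫⁻ x in chainCube k m v j, h (x + u) := by
    rw [← lintegral_indicator (measurableSet_chainCube _ _ _ _),
      ← lintegral_indicator (measurableSet_chainCube _ _ _ _), ← lintegral_add_right_eq_self _ u]
    refine lintegral_congr fun x => ?_
    by_cases hx : x ∈ chainCube k m v j
    · rw [Set.indicator_of_mem hx, Set.indicator_of_mem (add_mem_chainCube_succ.2 hx)]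
    · rw [Set.indicator_of_notMem hx, Set.indicator_of_notMem (mt add_mem_chainCube_succ.1 hx)]
  rw [hshift, ← lintegral_const_mul' _ _ ENNReal.ofReal_ne_top]
  refine lintegral_mono fun x => hh.le_of_forall_abs_sub_le hb fun i => ?_
  have hk : (0 : ℝ) ≤ 1 / k := by positivity
  have huv : |v i - m i| ≤ 1 := by
    simpa using abs_sub_le_of_le_of_le (hv.1 i) (hv.2 i) (hm.1 i) (hm.2 i)
  calc |x i - (x + u) i| = 1 / k * |v i - m i| := by
        rw [Pi.add_apply, sub_add_cancel_left, abs_neg, hu, abs_mul, abs_of_nonneg hk]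
    _ ≤ 1 / k := mul_le_of_le_one_right hk huv

theorem LogLipschitz.mul_le_setLIntegral_chainCube_zero (hh : LogLipschitz b h) (hb : 0 < b)
    (hm : m ∈ Set.Icc 0 1) :
    ENNReal.ofReal ((1 / k) ^ Fintype.card ι) * h m ≤
      ENNReal.ofReal (Real.exp (Fintype.card ι * (1 / k) / b)) *
        ∫⁻ x in chainCube k m v 0, h x := by
  rw [← lintegral_const_mul' _ _ ENNReal.ofReal_ne_top, ← volume_chainCube k m v 0, mul_comm,
    ← setLIntegral_const]
  refine setLIntegral_mono' (measurableSet_chainCube _ _ _ _) fun x hx =>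
    hh.le_of_forall_abs_sub_le hb fun i => ?_
  rw [abs_sub_comm]
  exact abs_sub_le_of_mem_chainCube_zero hm hx i

theorem LogLipschitz.setLIntegral_chainCube_zero_le (hh : LogLipschitz b h) (hb : 0 < b)
    (hm : m ∈ Set.Icc 0 1) :
    ∫⁻ x in chainCube k m v 0, h x ≤
      ENNReal.ofReal (Real.exp (Fintype.card ι * (1 / k) / b)) *
        (ENNReal.ofReal ((1 / k) ^ Fintype.card ι) * h m) := by
  rw [← volume_chainCube k m v 0, mul_left_comm, mul_comm (volume _), ← setLIntegral_const]
  exact setLIntegral_mono' (measurableSet_chainCube _ _ _ _) fun x hx =>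
    hh.le_of_forall_abs_sub_le hb fun i => abs_sub_le_of_mem_chainCube_zero hm hx i

theorem add_sum_range_succ_le_mul {R : Type*} [CommSemiring R] [PartialOrder R]
    [IsOrderedAddMonoid R] {A : ℕ → R} {a b L : R} {l : ℕ} (hstart : a ≤ L * A 0)
    (hstep : ∀ j, A j ≤ L * A (j + 1)) (hend : A l ≤ L * b) :
    a + ∑ j ∈ Finset.range (l + 1), A j ≤ L * (b + ∑ j ∈ Finset.range (l + 1), A j) :=
  calc a + ∑ j ∈ Finset.range (l + 1), A j
      = a + (∑ j ∈ Finset.range l, A j + A l) := by rw [Finset.sum_range_succ]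
    _ ≤ L * A 0 + (∑ j ∈ Finset.range l, L * A (j + 1) + L * b) :=
        add_le_add hstart (add_le_add (Finset.sum_le_sum fun j _ => hstep j) hend)
    _ = L * (b + ∑ j ∈ Finset.range (l + 1), A j) := by
        rw [Finset.sum_range_succ', ← Finset.mul_sum]; ring

theorem LogLipschitz.mul_add_setLIntegral_Icc_le (hh : LogLipschitz b h) (hb : 0 < b) (hk : 0 < k)
    (hm : m ∈ Set.Icc 0 1) (hv : v ∈ Set.Icc 0 1) {i : ι} (hi : |m i - v i| = 1) :
    ENNReal.ofReal ((1 / k) ^ Fintype.card ι) * h m + ∫⁻ x in Set.Icc 0 1, h x ≤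
      ENNReal.ofReal (Real.exp (Fintype.card ι * (1 / k) / b)) *
        (ENNReal.ofReal ((1 / k) ^ Fintype.card ι) * h v + ∫⁻ x in Set.Icc 0 1, h x) := by
  set V := ENNReal.ofReal ((1 / k) ^ Fintype.card ι)
  set L := ENNReal.ofReal (Real.exp (Fintype.card ι * (1 / k) / b)) with hL
  have hL1 : 1 ≤ L := by
    rw [hL, ENNReal.one_le_ofReal, Real.one_le_exp_iff]; positivity
  set A : ℕ → ℝ≥0∞ := fun j => ∫⁻ x in chainCube k m v j, h x
  set U := ⋃ j ∈ Finset.range k, chainCube k m v j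
  have hU : MeasurableSet U :=
    Finset.measurableSet_biUnion _ fun j _ => measurableSet_chainCube k m v j
  have hUI : U ⊆ Set.Icc 0 1 :=
    Set.iUnion₂_subset fun j hj => chainCube_subset_Icc hm hv (Finset.mem_range.1 hj)
  have hsplit : ∫⁻ x in Set.Icc 0 1, h x =
      ∑ j ∈ Finset.range k, A j + ∫⁻ x in Set.Icc 0 1 \ U, h x := by
    rw [← lintegral_biUnion_finset (fun _ _ _ _ hjl => disjoint_chainCube hi hk hjl)
        fun j _ => measurableSet_chainCube k m v j,
      ← lintegral_inter_add_sdiff h (Set.Icc 0 1) hU, Set.inter_eq_self_of_subset_right hUI]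
  have hchain : V * h m + ∑ j ∈ Finset.range k, A j ≤
      L * (V * h v + ∑ j ∈ Finset.range k, A j) := by
    have hlast : A (k - 1) ≤ L * (V * h v) := by
      simpa only [A, chainCube_last hk] using hh.setLIntegral_chainCube_zero_le hb hv
    rw [← Nat.sub_add_cancel hk]
    exact add_sum_range_succ_le_mul (hh.mul_le_setLIntegral_chainCube_zero hb hm)
      (hh.setLIntegral_chainCube_le_succ hb hm hv) hlast
  rw [hsplit, ← add_assoc, ← add_assoc, mul_add L]
  exact add_le_add hchain (le_mul_of_one_le_left' hL1)

/-- Moving a mass `p` from `m` to `v`, each cube of the chain passes its share of the uniform mass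
`ω` to the next one, so that the cost is determined by the side of the cubes and not by the
distance from `m` to `v`. -/
theorem LogLipschitz.transport_le (hh : LogLipschitz b h) (hb : 0 < b) (hk : 0 < k)
    (hm : m ∈ Set.Icc 0 1) (hv : v ∈ Set.Icc 0 1) {i : ι} (hi : |m i - v i| = 1) {p ω : ℝ≥0∞}
    (hp : p ≤ ω * ENNReal.ofReal ((1 / k) ^ Fintype.card ι)) :
    p * h m + ω * ∫⁻ x in Set.Icc 0 1, h x ≤
      ENNReal.ofReal (Real.exp (Fintype.card ι * (1 / k) / b)) *
        (p * h v + ω * ∫⁻ x in Set.Icc 0 1, h x) := by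
  have hcube := hh.mul_add_setLIntegral_Icc_le hb hk hm hv hi
  set V := ENNReal.ofReal ((1 / k) ^ Fintype.card ι) with hV
  set L := ENNReal.ofReal (Real.exp (Fintype.card ι * (1 / k) / b)) with hL
  set I := ∫⁻ x in Set.Icc 0 1, h x
  have hL1 : 1 ≤ L := by
    rw [hL, ENNReal.one_le_ofReal, Real.one_le_exp_iff]; positivity
  have hV0 : V ≠ 0 := by rw [hV, ne_eq, ENNReal.ofReal_eq_zero, not_le]; positivity
  obtain ⟨θ, rfl⟩ : ∃ θ, p = θ * V :=
    ⟨p / V, (ENNReal.div_mul_cancel hV0 ENNReal.ofReal_ne_top).symm⟩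
  obtain ⟨η, rfl⟩ : ∃ η, ω = θ + η :=
    exists_add_of_le ((ENNReal.mul_le_mul_iff_left hV0 ENNReal.ofReal_ne_top).1 hp)
  calc θ * V * h m + (θ + η) * I
      = θ * (V * h m + I) + η * I := by ring
    _ ≤ θ * (L * (V * h v + I)) + L * (η * I) :=
        add_le_add (mul_le_mul_right hcube θ) (le_mul_of_one_le_left' hL1)
    _ = L * (θ * V * h v + (θ + η) * I) := by ring

end Chain

/-! ### The parameters of the purification -/

theorem bits_pos {N : ℕ} (hN : 2 ≤ N) : 0 < bits N := Nat.clog_pos one_lt_two hN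

/-- The scale `2Δ / ε` of the noise of the purification, where `δ` is that of the mode release
algorithm and `d = bits N`; it does not depend on `ε`. -/
noncomputable def noiseScale (d : ℕ) : ℝ := 4 * (2 : ℝ) ^ (-(1 / d) : ℝ) / d ^ 2

/-- The side `(δ / (2ω))^(1/d)` of a cube whose mass under the uniform part of the mixture is
`δ / 2`. -/
noncomputable def cubeSide (N : ℕ) (ε : ℝ) : ℝ :=
  ε / (bits N : ℝ) ^ 3 * (2 : ℝ) ^ (-(1 / bits N) : ℝ)

theorem noiseScale_pos {d : ℕ} (hd : 0 < d) : 0 < noiseScale d := by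
  have : (0 : ℝ) < d := by exact_mod_cast hd
  unfold noiseScale
  positivity

section Parameters

variable {N : ℕ} {ε : ℝ} (hN : 2 ≤ N) (hε : 0 < ε)

include hN

theorem bits_mul_cubeSide_div_noiseScale :
    bits N * cubeSide N ε / noiseScale (bits N) = ε / 4 := by
  have hd : (0 : ℝ) < bits N := by exact_mod_cast bits_pos hN
  rw [cubeSide, noiseScale]
  field_simp

include hε

theorem cubeSide_pos : 0 < cubeSide N ε := by
  have hd : (0 : ℝ) < bits N := by exact_mod_cast bits_pos hN
  unfold cubeSide
  positivity

theorem inv_two_pow_mul_cubeSide_pow :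
    (2 : ℝ)⁻¹ ^ bits N * cubeSide N ε ^ bits N = Real.exp (-logInvDelta N ε) / 2 := by
  have hd : (0 : ℝ) < bits N := by exact_mod_cast bits_pos hN
  have hhalf : ((2 : ℝ) ^ (-(1 / bits N) : ℝ)) ^ bits N = 2⁻¹ := by
    rw [← Real.rpow_natCast, ← Real.rpow_mul (by norm_num), neg_mul, one_div,
      inv_mul_cancel₀ hd.ne', Real.rpow_neg_one]
  have hδ : Real.exp (-logInvDelta N ε) = (ε / (2 * (bits N : ℝ) ^ 3)) ^ bits N := by
    rw [logInvDelta, ← mul_neg, ← Real.log_inv, mul_comm, ← Real.rpow_def_of_pos (by positivity),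
      Real.rpow_natCast, inv_div]
  rw [cubeSide, mul_pow, hhalf, hδ, ← mul_assoc, ← mul_pow, div_eq_mul_inv _ (2 : ℝ)]
  congr 2
  field_simp

theorem rpow_exp_neg_logInvDelta :
    (Real.exp (-logInvDelta N ε) / (2 * (2 : ℝ)⁻¹ ^ bits N)) ^ (1 / (bits N : ℝ)) =
      cubeSide N ε := by
  have hcube : Real.exp (-logInvDelta N ε) / (2 * (2 : ℝ)⁻¹ ^ bits N) =
      cubeSide N ε ^ bits N := by
    rw [← div_div, ← inv_two_pow_mul_cubeSide_pow hN hε]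
    field_simp
  rw [hcube, one_div, Real.pow_rpow_inv_natCast (cubeSide_pos hN hε).le (bits_pos hN).ne']

theorem two_mul_purifyDelta_div :
    2 * purifyDelta (bits N) ∞ 1 (Real.exp (-logInvDelta N ε)) ((2 : ℝ)⁻¹ ^ bits N) / ε =
      noiseScale (bits N) := by
  have hd : (0 : ℝ) < bits N := by exact_mod_cast bits_pos hN
  rw [purifyDelta, rpow_exp_neg_logInvDelta hN hε, noiseScale, cubeSide]
  simp only [ENNReal.div_top, ENNReal.toReal_zero, sub_zero, Real.rpow_one]
  field_simp
  norm_num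

theorem logInvDelta_nonneg_of_cubeSide_le_one (hside : cubeSide N ε ≤ 1) :
    0 ≤ logInvDelta N ε := by
  have hvolume : cubeSide N ε ^ bits N ≤ 1 := pow_le_one₀ (cubeSide_pos hN hε).le hside
  have hω : (2 : ℝ)⁻¹ ^ bits N ≤ 2⁻¹ :=
    pow_le_of_le_one (by norm_num) (by norm_num) (bits_pos hN).ne'
  have hδ : Real.exp (-logInvDelta N ε) / 2 ≤ 2⁻¹ * 1 := by
    have := (cubeSide_pos hN hε).le
    rw [← inv_two_pow_mul_cubeSide_pow hN hε]
    gcongr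
  have : Real.exp (-logInvDelta N ε) ≤ 1 := by linarith
  linarith [Real.exp_le_one_iff.1 this]

end Parameters

/-! ### The law of the output -/

theorem measurable_roundCube {d : ℕ} : Measurable (roundCube : (Fin d → ℝ) → Fin d → Bool) :=
  measurable_pi_lambda _ fun i =>
    measurable_to_bool <| by
      simpa [roundCube, Set.preimage] using
        measurableSet_le (measurable_const (a := (1 / 2 : ℝ))) (measurable_pi_apply i)

theorem measurable_decode_roundCube {N : ℕ} (bot : Fin N) :
    Measurable fun z : Fin (bits N) → ℝ => decode bot (roundCube z) :=
  (measurable_of_finite (decode bot)).comp measurable_roundCube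

theorem binMap_mem_Icc {N : ℕ} (u : Fin N) : binMap u ∈ Set.Icc (0 : Fin (bits N) → ℝ) 1 := by
  constructor <;> intro i <;> by_cases hi : (u : ℕ).testBit i <;> simp [binMap, hi]

theorem exists_abs_binMap_sub_eq_one {N : ℕ} {u v : Fin N} (huv : binMap u ≠ binMap v) :
    ∃ i, |binMap u i - binMap v i| = 1 := by
  obtain ⟨i, hi⟩ := Function.ne_iff.1 huv
  refine ⟨i, ?_⟩
  by_cases hu : (u : ℕ).testBit i <;> by_cases hv : (v : ℕ).testBit i <;>
    simp_all [binMap]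

theorem volume_unitCube (d : ℕ) : volume (Set.Icc (0 : Fin d → ℝ) 1) = 1 := by
  simp [Real.volume_Icc_pi]

theorem ofReal_one_sub_add_ofReal {x : ℝ} (hx₀ : 0 ≤ x) (hx₁ : x ≤ 1) :
    ENNReal.ofReal (1 - x) + ENNReal.ofReal x = 1 := by
  rw [← ENNReal.ofReal_add (by linarith) hx₀, sub_add_cancel, ENNReal.ofReal_one]

/-- The law of the point to which the purification of an output with law `μ` adds noise: a vertex of
the cube with law `μ`, or, with probability `2^{-d}`, a uniform point of the cube. -/
noncomputable def cubeMixture {N : ℕ} (μ : Measure (Fin N)) : Measure (Fin (bits N) → ℝ) :=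
  ENNReal.ofReal (1 - (2 : ℝ)⁻¹ ^ bits N) • μ.map binMap +
    ENNReal.ofReal ((2 : ℝ)⁻¹ ^ bits N) • volume.restrict (Set.Icc 0 1)

section CubeMixture

variable {N : ℕ} (μ : Measure (Fin N))

instance [IsProbabilityMeasure μ] : IsProbabilityMeasure (cubeMixture μ) := by
  have := Measure.isProbabilityMeasure_map (μ := μ) (measurable_of_finite binMap).aemeasurable
  constructor
  simp only [cubeMixture, Measure.add_apply, Measure.smul_apply, measure_univ,
    Measure.restrict_apply_univ, volume_unitCube, smul_eq_mul, mul_one]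
  exact ofReal_one_sub_add_ofReal (by positivity) (pow_le_one₀ (by norm_num) (by norm_num))

theorem lintegral_cubeMixture {h : (Fin (bits N) → ℝ) → ℝ≥0∞} (hh : Measurable h) :
    ∫⁻ x, h x ∂cubeMixture μ =
      ENNReal.ofReal (1 - (2 : ℝ)⁻¹ ^ bits N) * ∫⁻ u, h (binMap u) ∂μ +
        ENNReal.ofReal ((2 : ℝ)⁻¹ ^ bits N) * ∫⁻ x in Set.Icc 0 1, h x := by
  rw [cubeMixture, lintegral_add_measure, lintegral_smul_measure, lintegral_smul_measure,
    lintegral_map hh (measurable_of_finite binMap), smul_eq_mul, smul_eq_mul]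

theorem ae_mem_Icc_cubeMixture : ∀ᵐ x ∂cubeMixture μ, x ∈ Set.Icc 0 1 := by
  have hvertex : ∀ᵐ x ∂μ.map binMap, x ∈ Set.Icc 0 1 :=
    (ae_map_iff (measurable_of_finite binMap).aemeasurable measurableSet_Icc).2 <|
      Filter.Eventually.of_forall binMap_mem_Icc
  exact ae_add_measure_iff.2 ⟨Measure.ae_smul_measure hvertex _,
    Measure.ae_smul_measure (ae_restrict_mem measurableSet_Icc) _⟩

end CubeMixture

/-- The probability that the purification ends up in `S` if it adds its noise to the point `x`. -/
noncomputable def outputProb {N : ℕ} (bot : Fin N) (S : Set (Fin N)) (x : Fin (bits N) → ℝ) :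
    ℝ≥0∞ :=
  noisyProb (noiseScale (bits N)) ((fun z => decode bot (roundCube z)) ⁻¹' S) x

theorem measurable_outputProb {N : ℕ} (bot : Fin N) (S : Set (Fin N)) :
    Measurable (outputProb bot S) :=
  measurable_noisyProb _ (measurable_decode_roundCube bot S.to_countable.measurableSet)

theorem logLipschitz_outputProb {N : ℕ} (hN : 2 ≤ N) (bot : Fin N) (S : Set (Fin N)) :
    LogLipschitz (noiseScale (bits N)) (outputProb bot S) :=
  logLipschitz_noisyProb (noiseScale_pos (bits_pos hN))
    (measurable_decode_roundCube bot S.to_countable.measurableSet)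

section Law

variable {n N : ℕ} [NeZero N] {ε : ℝ}

theorem measurable_test (ε : ℝ) (bot : Fin N) (D : Fin n → Fin N) :
    Measurable fun z : ℝ =>
      if (instabilityDist D : ℝ) - 1 + z ≤ logInvDelta N ε / ε then bot else mode D :=
  Measurable.ite (measurableSet_le (by fun_prop) (by fun_prop)) measurable_const measurable_const

theorem isProbabilityMeasure_approxMode (hε : 0 < ε) (bot : Fin N) (D : Fin n → Fin N) :
    IsProbabilityMeasure (approxMode ε bot D) := by
  have := isProbabilityMeasure_laplace (b := 1 / ε) (by positivity)
  exact Measure.isProbabilityMeasure_map (measurable_test ε bot D).aemeasurable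

theorem modeRelease_eq_map (hN : 2 ≤ N) (hε : 0 < ε) (bot : Fin N) (D : Fin n → Fin N) :
    modeRelease ε bot D =
      (cubeMixture (approxMode ε bot D) ∗
        Measure.pi fun _ => laplace (noiseScale (bits N))).map
          fun z => decode bot (roundCube z) := by
  rw [modeRelease, purifyDiscrete, purify, two_mul_purifyDelta_div hN hε, cubeMixture,
    ProbabilityTheory.cond, volume_unitCube, inv_one, one_smul]

theorem isProbabilityMeasure_modeRelease (hN : 2 ≤ N) (hε : 0 < ε) (bot : Fin N)
    (D : Fin n → Fin N) : IsProbabilityMeasure (modeRelease ε bot D) := by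
  have := isProbabilityMeasure_approxMode hε bot D
  have := isProbabilityMeasure_laplace (noiseScale_pos (bits_pos hN))
  rw [modeRelease_eq_map hN hε]
  exact Measure.isProbabilityMeasure_map (measurable_decode_roundCube bot).aemeasurable

theorem modeRelease_apply (hN : 2 ≤ N) (hε : 0 < ε) (bot : Fin N) (D : Fin n → Fin N)
    (S : Set (Fin N)) :
    modeRelease ε bot D S = ∫⁻ x, outputProb bot S x ∂cubeMixture (approxMode ε bot D) := by
  have := isProbabilityMeasure_laplace (noiseScale_pos (bits_pos hN))
  have hS : MeasurableSet S := S.to_countable.measurableSet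
  have hevent := measurable_decode_roundCube bot hS
  rw [modeRelease_eq_map hN hε, Measure.map_apply (measurable_decode_roundCube bot) hS,
    ← lintegral_indicator_one hevent, Measure.lintegral_conv (measurable_one.indicator hevent)]
  refine lintegral_congr fun x => ?_
  rw [outputProb, noisyProb, ← lintegral_indicator_one (measurable_const_add x hevent)]
  rfl

end Law

/-! ### Sensitivity of the mode -/

section Sensitivity

variable {n N : ℕ} {D D' : Fin n → Fin N}

theorem freq_le_freq_add_hammingDist (D D' : Fin n → Fin N) (x : Fin N) :
    freq D x ≤ freq D' x + hammingDist D D' := by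
  refine (Finset.card_le_card fun i hi => ?_).trans (Finset.card_union_le _ _)
  by_cases hD : D i = D' i <;> simp_all

variable [NeZero N]

theorem freq_le_freq_mode (D : Fin n → Fin N) (x : Fin N) : freq D x ≤ freq D (mode D) :=
  (Finset.mem_filter.1 ((modes D).min'_mem (modes_nonempty D))).2 x

theorem freq_le_occ₂ {x : Fin N} (hx : x ≠ mode D) : freq D x ≤ occ₂ D :=
  Finset.le_sup (f := freq D) (by simp [hx])

theorem occ₂_le_occ₁ (D : Fin n → Fin N) : occ₂ D ≤ occ₁ D :=
  Finset.sup_le fun x _ => freq_le_freq_mode D x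

theorem occ₁_le_occ₁_add_hammingDist (D D' : Fin n → Fin N) :
    occ₁ D ≤ occ₁ D' + hammingDist D D' :=
  (freq_le_freq_add_hammingDist D D' _).trans (Nat.add_le_add_right (freq_le_freq_mode D' _) _)

theorem occ₂_le_occ₂_add_hammingDist (hmode : mode D = mode D') :
    occ₂ D ≤ occ₂ D' + hammingDist D D' :=
  Finset.sup_le fun x hx => (freq_le_freq_add_hammingDist D D' x).trans <|
    Nat.add_le_add_right (freq_le_occ₂ (hmode ▸ Finset.ne_of_mem_erase hx)) _

theorem instabilityDist_le_one_of_mode_ne (hD : hammingDist D D' ≤ 1) (hmode : mode D ≠ mode D') :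
    instabilityDist D ≤ 1 := by
  have hgap : occ₁ D ≤ occ₂ D + 2 := by
    have hlose := freq_le_freq_add_hammingDist D D' (mode D)
    have hgain := freq_le_freq_add_hammingDist D' D (mode D')
    have hbeaten := freq_le_freq_mode D' (mode D)
    have hsecond := freq_le_occ₂ hmode.symm
    rw [hammingDist_comm] at hgain
    unfold occ₁
    omega
  have : (occ₁ D : ℝ) ≤ occ₂ D + 2 := by exact_mod_cast hgap
  rw [instabilityDist, Int.ceil_le, Int.cast_one]
  linarith

theorem instabilityDist_le_add_one_of_mode_eq (hD : hammingDist D D' ≤ 1)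
    (hmode : mode D = mode D') : (instabilityDist D : ℝ) ≤ instabilityDist D' + 1 := by
  have hocc₁ : (occ₁ D : ℝ) ≤ occ₁ D' + 1 := by
    exact_mod_cast (occ₁_le_occ₁_add_hammingDist D D').trans (Nat.add_le_add_left hD _)
  have hocc₂ : (occ₂ D' : ℝ) ≤ occ₂ D + 1 := by
    rw [hammingDist_comm] at hD
    exact_mod_cast (occ₂_le_occ₂_add_hammingDist hmode.symm).trans (Nat.add_le_add_left hD _)
  have hceil := Int.le_ceil (((occ₁ D' : ℝ) - occ₂ D') / 2)
  have : instabilityDist D ≤ instabilityDist D' + 1 := by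
    rw [instabilityDist, Int.ceil_le]
    push_cast [instabilityDist]
    linarith
  exact_mod_cast this

theorem abs_instabilityDist_sub_le_one (hD : hammingDist D D' ≤ 1) (hmode : mode D = mode D') :
    |(instabilityDist D : ℝ) - instabilityDist D'| ≤ 1 := by
  have hle := instabilityDist_le_add_one_of_mode_eq hD hmode
  have hge := instabilityDist_le_add_one_of_mode_eq (hammingDist_comm D' D ▸ hD) hmode.symm
  rw [abs_le]
  constructor <;> linarith

end Sensitivity

/-! ### Privacy -/

theorem exists_nat_le_one_div_le_two_mul {r : ℝ} (hr₀ : 0 < r) (hr₁ : r ≤ 1) :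
    ∃ k : ℕ, 0 < k ∧ r ≤ 1 / k ∧ (1 : ℝ) / k ≤ 2 * r := by
  have hfloor : (1 : ℝ) ≤ ⌊r⁻¹⌋₊ := by
    exact_mod_cast (Nat.one_le_floor_iff _).2 ((one_le_inv₀ hr₀).2 hr₁)
  refine ⟨⌊r⁻¹⌋₊, by exact_mod_cast hfloor, ?_, ?_⟩
  · rw [le_one_div hr₀ (by linarith), one_div]
    exact Nat.floor_le (by positivity)
  · have hlt := Nat.lt_floor_add_one r⁻¹
    rw [inv_lt_iff_one_lt_mul₀ hr₀] at hlt
    rw [div_le_iff₀ (by linarith)]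
    nlinarith

theorem LogLipschitz.transport_binMap_le {N : ℕ} {ε : ℝ} {h : (Fin (bits N) → ℝ) → ℝ≥0∞}
    (hh : LogLipschitz (noiseScale (bits N)) h) (hN : 2 ≤ N) (hε : 0 < ε)
    (hside : cubeSide N ε ≤ 1) {p : ℝ≥0∞}
    (hp : p ≤ ENNReal.ofReal (Real.exp (-logInvDelta N ε) / 2)) (u v : Fin N) :
    p * h (binMap u) + ENNReal.ofReal ((2 : ℝ)⁻¹ ^ bits N) * ∫⁻ x in Set.Icc 0 1, h x ≤
      ENNReal.ofReal (Real.exp (ε / 2)) *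
        (p * h (binMap v) + ENNReal.ofReal ((2 : ℝ)⁻¹ ^ bits N) * ∫⁻ x in Set.Icc 0 1, h x) := by
  by_cases huv : binMap u = binMap v
  · rw [huv]
    refine le_mul_of_one_le_left' ?_
    rw [ENNReal.one_le_ofReal, Real.one_le_exp_iff]
    positivity
  obtain ⟨i, hi⟩ := exists_abs_binMap_sub_eq_one huv
  obtain ⟨k, hk, hside_le, hle_side⟩ :=
    exists_nat_le_one_div_le_two_mul (cubeSide_pos hN hε) hside
  have hb := noiseScale_pos (bits_pos hN)
  have hmass : p ≤ ENNReal.ofReal ((2 : ℝ)⁻¹ ^ bits N) *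
      ENNReal.ofReal ((1 / k) ^ Fintype.card (Fin (bits N))) := by
    rw [← ENNReal.ofReal_mul (by positivity), Fintype.card_fin]
    refine hp.trans ?_
    rw [← inv_two_pow_mul_cubeSide_pow hN hε]
    have := (cubeSide_pos hN hε).le
    gcongr
  have hexp : (Fintype.card (Fin (bits N)) : ℝ) * (1 / k) / noiseScale (bits N) ≤ ε / 2 :=
    calc (Fintype.card (Fin (bits N)) : ℝ) * (1 / k) / noiseScale (bits N)
        ≤ bits N * (2 * cubeSide N ε) / noiseScale (bits N) := by
          rw [Fintype.card_fin]
          gcongr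
      _ = 2 * (bits N * cubeSide N ε / noiseScale (bits N)) := by ring
      _ = ε / 2 := by rw [bits_mul_cubeSide_div_noiseScale hN]; ring
  refine (hh.transport_le hb hk (binMap_mem_Icc u) (binMap_mem_Icc v) hi hmass).trans ?_
  gcongr

/-- The probability that the distance-to-instability test succeeds. -/
noncomputable def passProb {n N : ℕ} [NeZero N] (ε : ℝ) (D : Fin n → Fin N) : ℝ≥0∞ :=
  laplace (1 / ε) (Set.Ioi (logInvDelta N ε / ε - ((instabilityDist D : ℝ) - 1)))

section Privacy

variable {n N : ℕ} [NeZero N] {D D' : Fin n → Fin N} {ε : ℝ}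

theorem lintegral_approxMode (hε : 0 < ε) (bot : Fin N) (D : Fin n → Fin N) (g : Fin N → ℝ≥0∞) :
    ∫⁻ u, g u ∂approxMode ε bot D =
      passProb ε D * g (mode D) + (1 - passProb ε D) * g bot := by
  have := isProbabilityMeasure_laplace (b := 1 / ε) (by positivity)
  rw [passProb, ← prob_compl_eq_one_sub measurableSet_Ioi, mul_comm, mul_comm _ (g bot),
    ← setLIntegral_const, ← setLIntegral_const, approxMode,
    lintegral_map (measurable_of_finite g) (measurable_test ε bot D),
    ← lintegral_add_compl _ (measurableSet_Ioi
      (a := logInvDelta N ε / ε - ((instabilityDist D : ℝ) - 1)))]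
  congr 1
  · refine setLIntegral_congr_fun measurableSet_Ioi fun z hz => ?_
    rw [Set.mem_Ioi, sub_lt_iff_lt_add'] at hz
    simp only [if_neg hz.not_ge]
  · refine setLIntegral_congr_fun measurableSet_Ioi.compl fun z hz => ?_
    rw [Set.compl_Ioi, Set.mem_Iic, le_sub_iff_add_le'] at hz
    simp only [if_pos hz]

theorem approxMode_le_of_mode_eq (hε : 0 < ε) (bot : Fin N) (hD : hammingDist D D' ≤ 1)
    (hmode : mode D = mode D') :
    approxMode ε bot D ≤ ENNReal.ofReal (Real.exp ε) • approxMode ε bot D' := by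
  have htest : Measurable fun y : ℝ => if y ≤ logInvDelta N ε / ε then bot else mode D' :=
    Measurable.ite measurableSet_Iic measurable_const measurable_const
  have heq (E : Fin n → Fin N) (hE : mode E = mode D') : approxMode ε bot E =
      ((laplace (1 / ε)).map fun z => (instabilityDist E : ℝ) - 1 + z).map
        fun y => if y ≤ logInvDelta N ε / ε then bot else mode D' := by
    rw [Measure.map_map htest (measurable_const_add _), approxMode, hE]
    rfl
  have hexp : |((instabilityDist D : ℝ) - 1) - ((instabilityDist D' : ℝ) - 1)| / (1 / ε) ≤ ε := by
    rw [sub_sub_sub_cancel_right, div_div_eq_mul_div, div_one]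
    exact mul_le_of_le_one_left hε.le (abs_instabilityDist_sub_le_one hD hmode)
  rw [heq D hmode, heq D' rfl, ← Measure.map_smul]
  refine Measure.map_mono ((map_add_left_laplace_le (by positivity) _
    ((instabilityDist D' : ℝ) - 1)).trans (Measure.le_iff.2 fun A _ => ?_)) htest
  simp only [Measure.smul_apply, smul_eq_mul]
  gcongr

theorem modeRelease_le_of_mode_eq (hN : 2 ≤ N) (hε : 0 < ε) (bot : Fin N)
    (hD : hammingDist D D' ≤ 1) (hmode : mode D = mode D') (S : Set (Fin N)) :
    modeRelease ε bot D S ≤ ENNReal.ofReal (Real.exp ε) * modeRelease ε bot D' S := by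
  have hE : 1 ≤ ENNReal.ofReal (Real.exp ε) := by
    rw [ENNReal.one_le_ofReal, Real.one_le_exp_iff]
    exact hε.le
  have happrox : ∫⁻ u, outputProb bot S (binMap u) ∂approxMode ε bot D ≤
      ENNReal.ofReal (Real.exp ε) *
        ∫⁻ u, outputProb bot S (binMap u) ∂approxMode ε bot D' := by
    rw [← smul_eq_mul, ← lintegral_smul_measure]
    exact lintegral_mono' (approxMode_le_of_mode_eq hε bot hD hmode) le_rfl
  rw [modeRelease_apply hN hε, modeRelease_apply hN hε,
    lintegral_cubeMixture _ (measurable_outputProb bot S),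
    lintegral_cubeMixture _ (measurable_outputProb bot S), mul_add, mul_left_comm]
  exact add_le_add (by gcongr) (le_mul_of_one_le_left' hE)

theorem modeRelease_le_of_one_lt_cubeSide (hN : 2 ≤ N) (hε : 0 < ε) (bot : Fin N)
    (hside : 1 < cubeSide N ε) (D D' : Fin n → Fin N) (S : Set (Fin N)) :
    modeRelease ε bot D S ≤ ENNReal.ofReal (Real.exp ε) * modeRelease ε bot D' S := by
  have hb := noiseScale_pos (bits_pos hN)
  have := isProbabilityMeasure_approxMode (n := n) hε bot
  have hexp : (Fintype.card (Fin (bits N)) : ℝ) / noiseScale (bits N) ≤ ε := by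
    have hscale : (bits N : ℝ) / noiseScale (bits N) ≤
        bits N * cubeSide N ε / noiseScale (bits N) := by
      gcongr
      exact le_mul_of_one_le_right (by positivity) hside.le
    rw [bits_mul_cubeSide_div_noiseScale hN] at hscale
    rw [Fintype.card_fin]
    linarith
  rw [modeRelease_apply hN hε, modeRelease_apply hN hε]
  refine ((logLipschitz_outputProb hN bot S).lintegral_le_of_ae_mem_Icc hb
    (ae_mem_Icc_cubeMixture (approxMode ε bot D))
    (ae_mem_Icc_cubeMixture (approxMode ε bot D'))).trans ?_
  gcongr

theorem passProb_le_one (hε : 0 < ε) (D : Fin n → Fin N) : passProb ε D ≤ 1 := by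
  have := isProbabilityMeasure_laplace (b := 1 / ε) (by positivity)
  exact prob_le_one

theorem passProb_le_of_instabilityDist_le_one (hε : 0 < ε) (hD : instabilityDist D ≤ 1)
    (hδ : 0 ≤ logInvDelta N ε) :
    passProb ε D ≤ ENNReal.ofReal (Real.exp (-logInvDelta N ε) / 2) := by
  have hD' : (instabilityDist D : ℝ) ≤ 1 := by exact_mod_cast hD
  calc passProb ε D ≤ laplace (1 / ε) (Set.Ioi (logInvDelta N ε / ε)) :=
        measure_mono (Set.Ioi_subset_Ioi (by linarith))
    _ = ENNReal.ofReal (Real.exp (-logInvDelta N ε) / 2) := by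
        rw [laplace_Ioi (by positivity) (by positivity), neg_div, div_div,
          mul_one_div_cancel hε.ne', div_one]

theorem modeRelease_le_purify_bot_and_purify_bot_le (hN : 2 ≤ N) (hε : 0 < ε) (bot : Fin N)
    (hside : cubeSide N ε ≤ 1) (hD : instabilityDist D ≤ 1) (S : Set (Fin N)) :
    modeRelease ε bot D S ≤ ENNReal.ofReal (Real.exp (ε / 2)) *
        ∫⁻ x, outputProb bot S x ∂cubeMixture (Measure.dirac bot) ∧
      ∫⁻ x, outputProb bot S x ∂cubeMixture (Measure.dirac bot) ≤
        ENNReal.ofReal (Real.exp (ε / 2)) * modeRelease ε bot D S := by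
  set L := ENNReal.ofReal (Real.exp (ε / 2)) with hL
  have hL1 : 1 ≤ L := by
    rw [hL, ENNReal.one_le_ofReal, Real.one_le_exp_iff]
    positivity
  set p := passProb ε D
  set w := ENNReal.ofReal (1 - (2 : ℝ)⁻¹ ^ bits N) with hw
  have hwp : w * p ≤ ENNReal.ofReal (Real.exp (-logInvDelta N ε) / 2) := by
    refine (mul_le_of_le_one_left' ?_).trans <| passProb_le_of_instabilityDist_le_one hε hD <|
      logInvDelta_nonneg_of_cubeSide_le_one hN hε hside
    rw [hw, ENNReal.ofReal_le_one, sub_le_self_iff]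
    positivity
  -- The two mixtures differ only in the mass `w * p`, at the vertex of `mode D` or of `bot`.
  have htransport :=
    (logLipschitz_outputProb hN bot S).transport_binMap_le hN hε hside hwp
  rw [modeRelease_apply hN hε, lintegral_cubeMixture _ (measurable_outputProb bot S),
    lintegral_cubeMixture _ (measurable_outputProb bot S), lintegral_approxMode hε,
    lintegral_dirac]
  set I := ENNReal.ofReal ((2 : ℝ)⁻¹ ^ bits N) * ∫⁻ x in Set.Icc 0 1, outputProb bot S x
  set q := outputProb bot S (binMap bot)
  set r := outputProb bot S (binMap (mode D))
  have hD_eq : w * (p * r + (1 - p) * q) + I = w * (1 - p) * q + (w * p * r + I) := by ring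
  have hbot_eq : w * q + I = w * (1 - p) * q + (w * p * q + I) :=
    calc w * q + I = w * ((1 - p) + p) * q + I := by
          rw [tsub_add_cancel_of_le (passProb_le_one hε D), mul_one]
      _ = w * (1 - p) * q + (w * p * q + I) := by ring
  rw [hD_eq, hbot_eq, mul_add L _ (w * p * q + I), mul_add L _ (w * p * r + I)]
  exact ⟨add_le_add (le_mul_of_one_le_left' hL1) (htransport (mode D) bot),
    add_le_add (le_mul_of_one_le_left' hL1) (htransport bot (mode D))⟩

theorem modeRelease_le_of_instabilityDist_le_one (hN : 2 ≤ N) (hε : 0 < ε) (bot : Fin N)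
    (hside : cubeSide N ε ≤ 1) (hD : instabilityDist D ≤ 1) (hD' : instabilityDist D' ≤ 1)
    (S : Set (Fin N)) :
    modeRelease ε bot D S ≤ ENNReal.ofReal (Real.exp ε) * modeRelease ε bot D' S :=
  calc modeRelease ε bot D S
      ≤ ENNReal.ofReal (Real.exp (ε / 2)) *
          ∫⁻ x, outputProb bot S x ∂cubeMixture (Measure.dirac bot) :=
        (modeRelease_le_purify_bot_and_purify_bot_le hN hε bot hside hD S).1
    _ ≤ ENNReal.ofReal (Real.exp (ε / 2)) *
          (ENNReal.ofReal (Real.exp (ε / 2)) * modeRelease ε bot D' S) := by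
        gcongr
        exact (modeRelease_le_purify_bot_and_purify_bot_le hN hε bot hside hD' S).2
    _ = ENNReal.ofReal (Real.exp ε) * modeRelease ε bot D' S := by
        rw [← mul_assoc, ← ENNReal.ofReal_mul (by positivity), ← Real.exp_add, add_halves]

theorem isDP_modeRelease (hN : 2 ≤ N) (hε : 0 < ε) (bot : Fin N) :
    IsDP ε 0 fun D : Fin n → Fin N => modeRelease ε bot D := by
  refine ⟨isProbabilityMeasure_modeRelease hN hε bot, fun D D' hD S _ => ?_⟩
  rw [ENNReal.ofReal_zero, add_zero]
  by_cases hmode : mode D = mode D'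
  · exact modeRelease_le_of_mode_eq hN hε bot hD hmode S
  rcases lt_or_ge 1 (cubeSide N ε) with hside | hside
  · exact modeRelease_le_of_one_lt_cubeSide hN hε bot hside D D' S
  · exact modeRelease_le_of_instabilityDist_le_one hN hε bot hside
      (instabilityDist_le_one_of_mode_ne hD hmode)
      (instabilityDist_le_one_of_mode_ne (hammingDist_comm D' D ▸ hD) (Ne.symm hmode)) S

end Privacy

theorem IsDP.mono {n : ℕ} {X Y : Type*} [DecidableEq X] [MeasurableSpace Y] {ε ε' δ : ℝ}
    {M : (Fin n → X) → Measure Y} (hM : IsDP ε δ M) (hε : ε ≤ ε') : IsDP ε' δ M := by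
  refine ⟨hM.1, fun D D' hD S hS => (hM.2 D D' hD S hS).trans ?_⟩
  gcongr

/-! ### Utility -/

theorem laplace_le_abs {b t : ℝ} (hb : 0 < b) (ht : 0 < t) :
    laplace b {z | t ≤ |z|} = ENNReal.ofReal (Real.exp (-t / b)) := by
  have : NullSingletonClass (laplace b) := by unfold laplace; infer_instance
  have hset : {z : ℝ | t ≤ |z|} = Set.Iic (-t) ∪ Set.Ici t := by
    ext z
    simp only [Set.mem_ofPred_eq, le_abs', Set.mem_union, Set.mem_Iic, Set.mem_Ici]
  rw [hset, measure_union (Set.Iic_disjoint_Ici.2 (by linarith)) measurableSet_Ici,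
    ← measure_congr Ioi_ae_eq_Ici, laplace_Iic hb (by linarith), laplace_Ioi hb ht.le,
    ← ENNReal.ofReal_add (by positivity) (by positivity), add_halves]

theorem pi_laplace_exists_le_abs_le {ι : Type*} [Fintype ι] {b t : ℝ} (hb : 0 < b)
    (ht : 0 < t) :
    Measure.pi (fun _ : ι => laplace b) {z | ∃ i, t ≤ |z i|} ≤
      Fintype.card ι * ENNReal.ofReal (Real.exp (-t / b)) := by
  have := isProbabilityMeasure_laplace hb
  have hmeas : MeasurableSet {z : ℝ | t ≤ |z|} := measurableSet_le measurable_const measurable_abs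
  rw [Set.ofPred_exists]
  refine (measure_iUnion_fintype_le _ _).trans_eq ?_
  have hcoord (i : ι) : Measure.pi (fun _ : ι => laplace b) {z | t ≤ |z i|} =
      ENNReal.ofReal (Real.exp (-t / b)) :=
    ((measurePreserving_eval (fun _ : ι => laplace b) i).measure_preimage
      hmeas.nullMeasurableSet).trans (laplace_le_abs hb ht)
  simp_rw [hcoord, Finset.sum_const, Finset.card_univ, nsmul_eq_mul]

theorem le_two_pow_bits (N : ℕ) : N ≤ 2 ^ bits N := Nat.le_pow_clog one_lt_two N

theorem inv_two_pow_bits_le_one_div {N : ℕ} (hN : 0 < N) : (2 : ℝ)⁻¹ ^ bits N ≤ 1 / N := by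
  rw [inv_pow, ← one_div]
  exact one_div_le_one_div_of_le (by exact_mod_cast hN) (by exact_mod_cast le_two_pow_bits N)

theorem decode_testBit {N : ℕ} (bot u : Fin N) :
    decode bot (fun i => (u : ℕ).testBit i) = u := by
  have hbits : Nat.ofBits (fun i : Fin (bits N) => (u : ℕ).testBit i) = u := by
    rw [Nat.ofBits_testBit]
    exact Nat.mod_eq_of_lt (u.2.trans_le (le_two_pow_bits N))
  simp only [decode, hbits, Fin.is_lt, dite_true]

theorem roundCube_binMap_add {N : ℕ} (u : Fin N) {z : Fin (bits N) → ℝ}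
    (hz : ∀ i, |z i| < 1 / 2) :
    roundCube (binMap u + z) = fun i : Fin (bits N) => (u : ℕ).testBit i := by
  funext i
  have hzi := abs_lt.1 (hz i)
  cases hbit : (u : ℕ).testBit i
  · simpa [roundCube, binMap, hbit] using hzi.2
  · simp only [roundCube, binMap, Pi.add_apply, hbit, if_true, decide_eq_true_eq]
    linarith

theorem one_sub_le_outputProb_binMap {N : ℕ} (hN : 2 ≤ N) (bot u : Fin N) :
    1 - bits N * Real.exp (-(1 / 2) / noiseScale (bits N)) ≤
      (outputProb bot {u} (binMap u)).toReal := by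
  have := isProbabilityMeasure_laplace (noiseScale_pos (bits_pos hN))
  set P := Measure.pi fun _ : Fin (bits N) => laplace (noiseScale (bits N))
  set bad := {z : Fin (bits N) → ℝ | ∃ i, 1 / 2 ≤ |z i|}
  have hbad : MeasurableSet bad := by
    simp only [bad, Set.ofPred_exists]
    exact .iUnion fun i => measurableSet_le measurable_const (measurable_pi_apply i).abs
  have hprob : P.real bad ≤ bits N * Real.exp (-(1 / 2) / noiseScale (bits N)) :=
    ENNReal.toReal_le_of_le_ofReal (by positivity) <| by
      rw [ENNReal.ofReal_mul (by positivity), ENNReal.ofReal_natCast]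
      simpa only [Fintype.card_fin] using pi_laplace_exists_le_abs_le
        (ι := Fin (bits N)) (noiseScale_pos (bits_pos hN)) one_half_pos
  have hgood : badᶜ ⊆
      (fun z => binMap u + z) ⁻¹' ((fun z => decode bot (roundCube z)) ⁻¹' {u}) := by
    intro z hz
    simp only [bad, Set.mem_compl_iff, Set.mem_ofPred_eq, not_exists, not_le] at hz
    rw [Set.mem_preimage, Set.mem_preimage, roundCube_binMap_add u hz, decode_testBit,
      Set.mem_singleton_iff]
  calc 1 - bits N * Real.exp (-(1 / 2) / noiseScale (bits N)) ≤ 1 - P.real bad := by gcongr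
    _ = P.real badᶜ := (probReal_compl_eq_one_sub hbad).symm
    _ ≤ (outputProb bot {u} (binMap u)).toReal := measureReal_mono hgood

theorem sq_div_eight_le_inv_noiseScale {d : ℕ} (hd : 0 < d) :
    (d : ℝ) ^ 2 / 8 ≤ 1 / 2 / noiseScale d := by
  have hpow : (2 : ℝ) ^ (-(1 / d) : ℝ) ≤ 1 :=
    Real.rpow_le_one_of_one_le_of_nonpos one_le_two (neg_nonpos.2 (by positivity))
  rw [le_div_iff₀ (noiseScale_pos hd)]
  calc (d : ℝ) ^ 2 / 8 * noiseScale d = (2 : ℝ) ^ (-(1 / d) : ℝ) / 2 := by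
        unfold noiseScale
        field_simp
        norm_num
    _ ≤ 1 / 2 := by gcongr

theorem bits_mul_exp_neg_inv_noiseScale_le {N : ℕ} (hN : 2 ≤ N) :
    bits N * Real.exp (-(1 / 2) / noiseScale (bits N)) ≤ Real.exp 8 / N := by
  have hscale := sq_div_eight_le_inv_noiseScale (bits_pos hN)
  have hpow : (N : ℝ) ≤ Real.exp (bits N) :=
    calc (N : ℝ) ≤ 2 ^ bits N := by exact_mod_cast le_two_pow_bits N
      _ ≤ Real.exp 1 ^ bits N := by
          gcongr
          exact Real.exp_one_gt_two.le
      _ = Real.exp (bits N) := by rw [← Real.exp_nat_mul, mul_one]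
  set d := bits N
  have hd : (d : ℝ) ≤ Real.exp d := by linarith [Real.add_one_le_exp (d : ℝ)]
  rw [le_div_iff₀ (by positivity), neg_div]
  calc (d : ℝ) * Real.exp (-(1 / 2 / noiseScale d)) * N
      ≤ Real.exp d * Real.exp (-((d : ℝ) ^ 2 / 8)) * Real.exp d := by gcongr
    _ = Real.exp (d + -((d : ℝ) ^ 2 / 8) + d) := by rw [Real.exp_add, Real.exp_add]
    _ ≤ Real.exp 8 := by
        rw [Real.exp_le_exp]
        nlinarith [sq_nonneg ((d : ℝ) - 8)]

section Utility

variable {n N : ℕ} [NeZero N] {ε : ℝ} {D : Fin n → Fin N}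

theorem one_sub_le_passProb (hε : 0 < ε)
    (hgap : ε + logInvDelta N ε + Real.log N ≤ ε * (((occ₁ D : ℝ) - occ₂ D) / 2)) :
    1 - 1 / (N : ℝ) ≤ (passProb ε D).toReal := by
  have := isProbabilityMeasure_laplace (b := 1 / ε) (by positivity)
  have hN : (0 : ℝ) < N := by exact_mod_cast Nat.pos_of_neZero N
  have hinst : ε + logInvDelta N ε + Real.log N ≤ ε * instabilityDist D :=
    hgap.trans (mul_le_mul_of_nonneg_left (Int.le_ceil _) hε.le)
  set t := logInvDelta N ε / ε - (instabilityDist D - 1) with ht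
  have htε : t * ε ≤ -Real.log N := by
    rw [ht, sub_mul, div_mul_cancel₀ _ hε.ne']
    linarith
  have ht₀ : t ≤ 0 :=
    nonpos_of_mul_nonpos_left (htε.trans (neg_nonpos.2 (Real.log_natCast_nonneg N))) hε
  have hexp : Real.exp (t / (1 / ε)) ≤ 1 / N := by
    rw [div_div_eq_mul_div, div_one]
    refine (Real.exp_le_exp.2 htε).trans_eq ?_
    rw [Real.exp_neg, Real.exp_log hN, one_div]
  calc 1 - 1 / (N : ℝ) ≤ 1 - Real.exp (t / (1 / ε)) / 2 := by
        linarith [Real.exp_pos (t / (1 / ε))]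
    _ = 1 - (laplace (1 / ε)).real (Set.Iic t) := by
        rw [measureReal_def, laplace_Iic (by positivity) ht₀, ENNReal.toReal_ofReal (by positivity)]
    _ = (passProb ε D).toReal := by
        rw [← probReal_compl_eq_one_sub measurableSet_Iic, Set.compl_Iic]
        rfl

theorem one_sub_le_modeRelease_mode (hN : 2 ≤ N) (hε : 0 < ε) (bot : Fin N)
    (hgap : ε + logInvDelta N ε + Real.log N ≤ ε * (((occ₁ D : ℝ) - occ₂ D) / 2)) :
    1 - (2 + Real.exp 8) / N ≤ (modeRelease ε bot D).real {mode D} := by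
  have := isProbabilityMeasure_modeRelease hN hε bot D
  have hω : (2 : ℝ)⁻¹ ^ bits N ≤ 1 / N := inv_two_pow_bits_le_one_div (by omega)
  have hω₀ : (0 : ℝ) ≤ (2 : ℝ)⁻¹ ^ bits N := by positivity
  have hω₁ : (2 : ℝ)⁻¹ ^ bits N ≤ 1 := pow_le_one₀ (by norm_num) (by norm_num)
  have hpass := one_sub_le_passProb hε hgap
  have hround := (sub_le_sub_left (bits_mul_exp_neg_inv_noiseScale_le hN) 1).trans
    (one_sub_le_outputProb_binMap hN bot (mode D))
  have hle : ENNReal.ofReal (1 - (2 : ℝ)⁻¹ ^ bits N) *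
      (passProb ε D * outputProb bot {mode D} (binMap (mode D))) ≤
        modeRelease ε bot D {mode D} := by
    rw [modeRelease_apply hN hε, lintegral_cubeMixture _ (measurable_outputProb bot _),
      lintegral_approxMode hε, mul_add, add_assoc]
    exact le_self_add
  have hle_real := ENNReal.toReal_mono (measure_ne_top _ _) hle
  rw [ENNReal.toReal_mul, ENNReal.toReal_mul, ENNReal.toReal_ofReal (by linarith)] at hle_real
  refine le_trans ?_ hle_real
  have hpass₁ : (passProb ε D).toReal ≤ 1 :=
    ENNReal.toReal_le_of_le_ofReal zero_le_one (by simpa using passProb_le_one hε D)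
  have hround₁ : (outputProb bot {mode D} (binMap (mode D))).toReal ≤ 1 := by
    have := isProbabilityMeasure_laplace (noiseScale_pos (bits_pos hN))
    exact measureReal_le_one
  set p := (passProb ε D).toReal
  set q := (outputProb bot {mode D} (binMap (mode D))).toReal
  set ω := (2 : ℝ)⁻¹ ^ bits N
  have hq₀ : 0 ≤ q := ENNReal.toReal_nonneg
  have hpq : p + q - 1 ≤ p * q := by nlinarith
  have hpq₁ : p * q ≤ 1 := mul_le_one₀ hpass₁ hq₀ hround₁
  calc 1 - (2 + Real.exp 8) / N = 1 - 1 / N + (1 - Real.exp 8 / N) - 1 - 1 / N := by ring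
    _ ≤ p + q - 1 - ω := by gcongr
    _ ≤ (1 - ω) * (p * q) := by nlinarith

end Utility

section Constant

variable {N : ℕ} {ε ε₀ : ℝ}

theorem bits_le_three_mul_log (hN : 2 ≤ N) : (bits N : ℝ) ≤ 3 * Real.log N := by
  have hlog_two : 2 / 3 < Real.log 2 := by linarith [Real.log_two_gt_d9]
  have hlog_le : Real.log 2 ≤ Real.log N := Real.log_le_log (by norm_num) (by exact_mod_cast hN)
  have hpow : ((2 : ℝ) ^ (bits N - 1)) ≤ N := by
    exact_mod_cast (Nat.pow_pred_clog_lt_self one_lt_two (by omega)).le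
  have hpred := Real.log_le_log (by positivity) hpow
  rw [Real.log_pow, Nat.cast_sub (bits_pos hN), Nat.cast_one] at hpred
  nlinarith

theorem logInvDelta_le (hN : 2 ≤ N) (hε : 0 < ε) (hε₀ : ε ≤ ε₀)
    (hlog : 0 ≤ Real.log (Real.log N / ε)) :
    logInvDelta N ε ≤ 3 * Real.log N *
      (Real.log 54 + 2 * Real.log (max ε₀ 1) + 3 * Real.log (Real.log N / ε)) := by
  have hd : (0 : ℝ) < bits N := by exact_mod_cast bits_pos hN
  have hlogN : 0 < Real.log N := Real.log_pos (by exact_mod_cast hN)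
  have : 0 < max ε₀ 1 := lt_max_of_lt_right one_pos
  have harg : 2 * (bits N : ℝ) ^ 3 / ε ≤ 54 * (max ε₀ 1) ^ 2 * (Real.log N / ε) ^ 3 :=
    calc 2 * (bits N : ℝ) ^ 3 / ε ≤ 2 * (3 * Real.log N) ^ 3 / ε := by
          gcongr
          exact bits_le_three_mul_log hN
      _ = 54 * ε ^ 2 * (Real.log N / ε) ^ 3 := by field_simp; norm_num
      _ ≤ 54 * (max ε₀ 1) ^ 2 * (Real.log N / ε) ^ 3 := by
          gcongr
          exact hε₀.trans (le_max_left _ _)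
  have hlog_arg : Real.log (2 * (bits N : ℝ) ^ 3 / ε) ≤
      Real.log 54 + 2 * Real.log (max ε₀ 1) + 3 * Real.log (Real.log N / ε) := by
    refine (Real.log_le_log (by positivity) harg).trans_eq ?_
    rw [Real.log_mul (by positivity) (by positivity), Real.log_mul (by positivity) (by positivity),
      Real.log_pow, Real.log_pow]
    norm_num
  have hmax_log : 0 ≤ Real.log (max ε₀ 1) := Real.log_nonneg (le_max_right _ _)
  calc logInvDelta N ε
      ≤ bits N * (Real.log 54 + 2 * Real.log (max ε₀ 1) + 3 * Real.log (Real.log N / ε)) := by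
        unfold logInvDelta
        gcongr
    _ ≤ _ := by
        gcongr
        exact bits_le_three_mul_log hN

/-- The constant of the utility bound, which comes from `bits N ≤ 3 * log N` and
`log c ≤ log (log N / ε)`. -/
noncomputable def utilityConst (ε₀ c : ℝ) : ℝ :=
  2 * ((2 + 3 * (Real.log 54 + 2 * Real.log (max ε₀ 1))) / Real.log c + 9)

theorem le_mul_half_of_utilityConst_mul_le {c g : ℝ} (hN : 2 ≤ N) (hc : 1 < c) (hε : 0 < ε)
    (hε₀ : ε ≤ ε₀) (hcε : c * ε ≤ Real.log N)
    (hg : utilityConst ε₀ c * (Real.log N * Real.log (Real.log N / ε) / ε) ≤ g) :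
    ε + logInvDelta N ε + Real.log N ≤ ε * (g / 2) := by
  have hlogc : 0 < Real.log c := Real.log_pos hc
  set L := Real.log N
  have hL : 0 < L := Real.log_pos (by exact_mod_cast hN)
  set M := Real.log (L / ε)
  have hcM : Real.log c ≤ M := Real.log_le_log (by linarith) (by rwa [le_div_iff₀ hε])
  set a := Real.log 54 + 2 * Real.log (max ε₀ 1) with ha
  have ha₀ : 0 ≤ a := by
    linarith [Real.log_nonneg (by norm_num : (1 : ℝ) ≤ 54), Real.log_nonneg (le_max_right ε₀ 1)]
  have hεL : ε ≤ L := by nlinarith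
  calc ε + logInvDelta N ε + L ≤ L + 3 * L * (a + 3 * M) + L := by
        gcongr
        exact logInvDelta_le hN hε hε₀ (hlogc.le.trans hcM)
    _ = (2 + 3 * a) * L * 1 + 9 * (L * M) := by ring
    _ ≤ (2 + 3 * a) * L * (M / Real.log c) + 9 * (L * M) := by
        gcongr
        rwa [one_le_div hlogc]
    _ = ε * (utilityConst ε₀ c * (L * M / ε) / 2) := by
        rw [utilityConst, ← ha]
        field_simp
    _ ≤ ε * (g / 2) := by gcongr

end Constant

/-! ### Executions of the machine -/

/-- The program `P`, started in `s`, reaches a configuration satisfying `Q` within `c` steps. -/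
def Reach (P : List Instr) (τ : Tape) (s : Config) (Q : Config → Prop) (c : ℕ) : Prop :=
  ∃ t ≤ c, Q (run P τ s t)

namespace Reach

variable {P : List Instr} {τ : Tape} {s : Config} {Q R : Config → Prop} {c c' : ℕ}

theorem done (h : Q s) : Reach P τ s Q c := ⟨0, Nat.zero_le _, h⟩

theorem mono (h : Reach P τ s Q c) (hc : c ≤ c') : Reach P τ s Q c' :=
  h.imp fun _ ⟨ht, hQ⟩ => ⟨ht.trans hc, hQ⟩

theorem step {I : Instr} (hI : P[s.pc]? = some I) (h : Reach P τ (I.exec τ s) Q c) :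
    Reach P τ s Q (c + 1) := by
  obtain ⟨t, ht, hQ⟩ := h
  have hstep : ModeRelease.step P τ s = I.exec τ s := by simp only [ModeRelease.step, hI]
  refine ⟨t + 1, by omega, ?_⟩
  rwa [run, Function.iterate_succ_apply, hstep]

theorem jumpLE {i j l : ℕ} (hI : P[s.pc]? = some (.jumpLE i j l))
    (h : s.reg i ≤ s.reg j → Reach P τ { s with pc := l } Q c)
    (h' : ¬ s.reg i ≤ s.reg j → Reach P τ s.next Q c) : Reach P τ s Q (c + 1) := by
  refine step hI ?_
  by_cases hle : s.reg i ≤ s.reg j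
  · simpa only [Instr.exec, hle, if_true] using h hle
  · simpa only [Instr.exec, hle, if_false] using h' hle

theorem jumpLER {i j l : ℕ} (hI : P[s.pc]? = some (.jumpLER i j l))
    (h : s.xreg i ≤ s.xreg j → Reach P τ { s with pc := l } Q c)
    (h' : ¬ s.xreg i ≤ s.xreg j → Reach P τ s.next Q c) : Reach P τ s Q (c + 1) := by
  refine step hI ?_
  by_cases hle : s.xreg i ≤ s.xreg j
  · simpa only [Instr.exec, hle, if_true] using h hle
  · simpa only [Instr.exec, hle, if_false] using h' hle

theorem trans (h : Reach P τ s Q c) (h' : ∀ s', Q s' → Reach P τ s' R c') :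
    Reach P τ s R (c + c') := by
  obtain ⟨t, ht, hQ⟩ := h
  obtain ⟨t', ht', hR⟩ := h' _ hQ
  refine ⟨t' + t, by omega, ?_⟩
  rwa [run, Function.iterate_add_apply]

theorem loop {J : ℕ → Config → Prop} {m : ℕ}
    (h : ∀ i < m, ∀ s, J i s → Reach P τ s (J (i + 1)) c) (h0 : J 0 s) :
    Reach P τ s (J m) (m * c) := by
  induction m with
  | zero => exact done h0
  | succ m ih =>
    rw [Nat.succ_mul]
    exact (ih fun i hi => h i (by omega)).trans (h m (by omega))

end Reach

theorem run_of_halted {P : List Instr} {τ : Tape} {s : Config} {t T : ℕ} (hT : t ≤ T)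
    (h : Halted P (run P τ s t)) : run P τ s T = run P τ s t := by
  obtain ⟨l, rfl⟩ := Nat.exists_eq_add_of_le' hT
  have hfix : step P τ (run P τ s t) = run P τ s t := by
    simp only [step, List.getElem?_eq_none h]
  rw [run, Function.iterate_add_apply]
  exact Function.iterate_fixed hfix l

/-! ### The program

The natural registers are used as follows: `0` holds `n` (at the end, the output), `1` holds `N`,
`2` holds `bot`, `3` the constant one, `12` the constant zero, `4` loop counters, `5` the mode,
`6` its frequency, `11` the second frequency, `13` the number `d` of bits, `14` the power `2 ^ d`,
`15` the bits still to be processed, `16` the part of the mixture (one for the noisy cube vertex),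
`17` the output word, `18` the value of its current bit, and `7`, `8`, `9` intermediate values.
The real register `0` holds `ε`, `1` holds `d`, `2` holds `1`, `4` the threshold of the test,
`7` the scale of the noise, `9` zero, `10` the weight `2⁻ᵈ`, `11` one half; `3`, `5`, `6` and `8`
hold intermediate values. Jump targets are lines of the whole program. -/

/-- Lines 0–15: count in `mem[n + y]` the occurrences of every `y`, keeping track of the mode. -/
def countCode : List Instr :=
  [.const 3 1,
    .jumpLE 0 4 16,
    .load 7 4,
    .add 8 0 7,
    .load 9 8,
    .add 9 9 3,
    .store 8 9,
    .jumpLE 9 6 10,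
    .add 5 7 12,
    .add 6 9 12,
    .add 8 9 3,
    .jumpLE 8 6 14,
    .jumpLE 5 7 14,
    .add 5 7 12,
    .add 4 4 3,
    .jump 1]

/-- Lines 16–26: erase the count of the mode, and compute the largest remaining count. -/
def secondCode : List Instr :=
  [.const 4 0,
    .add 8 0 5,
    .store 8 12,
    .jumpLE 0 4 27,
    .load 7 4,
    .add 8 0 7,
    .load 9 8,
    .jumpLE 9 11 25,
    .add 11 9 12,
    .add 4 4 3,
    .jump 19]

/-- Lines 27–31: compute the number of bits. -/
def bitsCode : List Instr :=
  [.const 14 1,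
    .jumpLE 1 14 32,
    .add 14 14 14,
    .add 13 13 3,
    .jump 28]

/-- Lines 32–52: the distance-to-instability test. -/
def testCode : List Instr :=
  [.sub 8 6 11,
    .add 8 8 3,
    .half 8 8,
    .cast 1 13,
    .cast 2 3,
    .addR 3 2 2,
    .mulR 4 1 1,
    .mulR 4 4 1,
    .mulR 4 3 4,
    .divR 4 4 0,
    .logR 4 4,
    .mulR 4 1 4,
    .divR 4 4 0,
    .cast 5 8,
    .subR 5 5 2,
    .drawLap 6,
    .divR 6 6 0,
    .addR 5 5 6,
    .add 15 2 12,
    .jumpLER 5 4 53,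
    .add 15 5 12]

/-- Lines 53–69: the parameters of the purification, and the choice of the part of the mixture. -/
def mixtureCode : List Instr :=
  [.logR 7 3,
    .divR 7 7 1,
    .subR 7 9 7,
    .expR 7 7,
    .divR 7 7 1,
    .divR 7 7 1,
    .addR 8 3 3,
    .mulR 7 8 7,
    .cast 10 14,
    .divR 10 2 10,
    .divR 11 2 3,
    .drawUnif 6,
    .const 16 1,
    .jumpLER 6 10 68,
    .const 16 0,
    .const 4 0,
    .const 18 1]

/-- Lines 70–86: add noise to the bits, one after the other, and round. -/
def roundCode : List Instr :=
  [.jumpLE 13 4 87,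
    .drawUnif 6,
    .drawLap 5,
    .half 8 15,
    .add 9 8 8,
    .sub 9 15 9,
    .jumpLE 3 16 78,
    .cast 6 9,
    .mulR 5 7 5,
    .addR 6 6 5,
    .add 15 8 12,
    .jumpLER 11 6 83,
    .jump 84,
    .add 17 17 18,
    .add 18 18 18,
    .add 4 4 3,
    .jump 70]

/-- Lines 87–89: decode the output word. -/
def outputCode : List Instr :=
  [.add 0 2 12,
    .jumpLE 1 17 90,
    .add 0 17 12]

/-- A program for the mode release algorithm. -/
def modeProgram : List Instr :=
  countCode ++ secondCode ++ bitsCode ++ testCode ++ mixtureCode ++ roundCode ++ outputCode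

/-! ### Counting -/

section Counting

variable {n N : ℕ}

/-- The number of occurrences of `y` among the first `i` records. -/
def prefixFreq (D : Fin n → Fin N) (i y : ℕ) : ℕ :=
  Nat.count (fun j => ∃ h : j < n, (D ⟨j, h⟩ : ℕ) = y) i

theorem prefixFreq_succ (D : Fin n → Fin N) (i : Fin n) (y : ℕ) :
    prefixFreq D (i + 1) y = prefixFreq D i y + if (D i : ℕ) = y then 1 else 0 := by
  simp only [prefixFreq, Nat.count_succ, Fin.is_lt, exists_true_left]

theorem prefixFreq_length (D : Fin n → Fin N) (x : Fin N) : prefixFreq D n x = freq D x := by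
  rw [prefixFreq, Nat.count_eq_card_filter_range, freq,
    ← Finset.card_map Fin.valEmbedding]
  congr 1
  ext j
  simp only [Finset.mem_filter, Finset.mem_range, Finset.mem_map, Finset.mem_univ, true_and,
    Fin.valEmbedding_apply, Fin.ext_iff]
  exact ⟨fun ⟨_, h, hx⟩ => ⟨⟨j, h⟩, hx, rfl⟩, by rintro ⟨k, hx, rfl⟩; exact ⟨k.2, k.2, hx⟩⟩

/-- Among the first `i` records, `md` is the mode and `best` its frequency. -/
structure IsPrefixMode (D : Fin n → Fin N) (i md best : ℕ) : Prop where
  lt : md < N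
  eq : best = prefixFreq D i md
  le : ∀ y, prefixFreq D i y ≤ best
  min : ∀ y < N, prefixFreq D i y = best → md ≤ y

theorem isPrefixMode_zero [NeZero N] (D : Fin n → Fin N) : IsPrefixMode D 0 0 0 :=
  ⟨NeZero.pos N, rfl, fun _ => le_rfl, fun _ _ _ => Nat.zero_le _⟩

theorem IsPrefixMode.succ_of_le {D : Fin n → Fin N} {i : Fin n} {md best : ℕ}
    (h : IsPrefixMode D i md best) (hle : prefixFreq D (i + 1) (D i) ≤ best)
    (hmd : prefixFreq D (i + 1) (D i) = best → md ≤ D i) : IsPrefixMode D (i + 1) md best := by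
  have hsucc := prefixFreq_succ D i
  have hself : prefixFreq D (i + 1) (D i) = prefixFreq D i (D i) + 1 := by
    rw [hsucc, if_pos rfl]
  have hne : (D i : ℕ) ≠ md := fun hcon => by
    have := h.eq
    rw [← hcon] at this
    omega
  refine ⟨h.lt, by rw [hsucc, if_neg hne, h.eq, Nat.add_zero], fun y => ?_, fun y hy hyb => ?_⟩
  · obtain rfl | hxy := eq_or_ne (D i : ℕ) y
    · exact hle
    · rw [hsucc, if_neg hxy]
      exact h.le y
  · obtain rfl | hxy := eq_or_ne (D i : ℕ) y
    · exact hmd hyb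
    · rw [hsucc, if_neg hxy] at hyb
      exact h.min y hy hyb

theorem IsPrefixMode.succ_of_ge {D : Fin n → Fin N} {i : Fin n} {md best : ℕ}
    (h : IsPrefixMode D i md best) (hle : best ≤ prefixFreq D (i + 1) (D i))
    (hmd : prefixFreq D (i + 1) (D i) = best → D i ≤ md) :
    IsPrefixMode D (i + 1) (D i) (prefixFreq D (i + 1) (D i)) := by
  have hsucc := prefixFreq_succ D i
  refine ⟨(D i).2, rfl, fun y => ?_, fun y hy hyb => ?_⟩
  · obtain rfl | hxy := eq_or_ne (D i : ℕ) y
    · exact le_rfl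
    · rw [hsucc y, if_neg hxy]
      exact (h.le y).trans hle
  · obtain rfl | hxy := eq_or_ne (D i : ℕ) y
    · exact le_rfl
    · rw [hsucc y, if_neg hxy, Nat.add_zero] at hyb
      have hbest : prefixFreq D (i + 1) (D i) = best := (hyb ▸ h.le y).antisymm hle
      exact (hmd hbest).trans (h.min y hy (hyb.trans hbest))

theorem mode_eq_of_forall [NeZero N] {D : Fin n → Fin N} {x : Fin N}
    (hmax : ∀ y, freq D y ≤ freq D x) (hmin : ∀ y, freq D y = freq D x → x ≤ y) :
    mode D = x :=
  (Finset.min'_le _ _ (Finset.mem_filter.2 ⟨Finset.mem_univ x, hmax⟩)).antisymm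
    (hmin _ ((hmax _).antisymm (freq_le_freq_mode D x)))

theorem IsPrefixMode.eq_mode [NeZero N] {D : Fin n → Fin N} {md best : ℕ}
    (h : IsPrefixMode D n md best) : md = mode D ∧ best = occ₁ D := by
  have hbest : best = freq D ⟨md, h.lt⟩ := h.eq.trans (prefixFreq_length D ⟨md, h.lt⟩)
  have hmode : mode D = ⟨md, h.lt⟩ := mode_eq_of_forall
    (fun y => (prefixFreq_length D y).symm.trans_le ((h.le y).trans hbest.le))
    fun y hy => h.min y y.2 (((prefixFreq_length D y).trans hy).trans hbest.symm)
  exact ⟨(congrArg Fin.val hmode).symm, hbest.trans (congrArg (freq D) hmode.symm)⟩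

end Counting

/-! ### Correctness of the program: the frequencies -/

section Frequencies

variable {n N : ℕ} {ε : ℝ} {bot : Fin N} {D : Fin n → Fin N} {τ : Tape} {s : Config}

/-- The contents of the registers that are never written again after the first line. -/
structure Consts (bot : Fin N) (s : Config) : Prop where
  reg1 : s.reg 1 = N
  reg2 : s.reg 2 = bot
  reg3 : s.reg 3 = 1
  reg12 : s.reg 12 = 0

/-- The contents of the registers and of the memory that stay unchanged until the random numbers
are drawn. -/
structure Frame (ε : ℝ) (bot : Fin N) (D : Fin n → Fin N) (s : Config) : Prop
    extends Consts bot s where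
  reg0 : s.reg 0 = n
  reg17 : s.reg 17 = 0
  xreg0 : s.xreg 0 = ε
  xreg9 : s.xreg 9 = 0
  draws : s.draws = 0
  mem : ∀ j : Fin n, s.mem j = D j

/-- The invariant of the counting loop, before the record `i` is read. -/
structure CountInv (ε : ℝ) (bot : Fin N) (D : Fin n → Fin N) (i : ℕ) (s : Config) : Prop
    extends Frame ε bot D s where
  pc : s.pc = 1
  reg4 : s.reg 4 = i
  reg11 : s.reg 11 = 0
  reg13 : s.reg 13 = 0
  count : ∀ y, s.mem (n + y) = prefixFreq D i y
  isPrefixMode : IsPrefixMode D i (s.reg 5) (s.reg 6)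

/-- The record `i` has been counted, but the mode has not been updated yet. -/
structure Counted (ε : ℝ) (bot : Fin N) (D : Fin n → Fin N) (i : Fin n) (s : Config) : Prop
    extends Frame ε bot D s where
  pc : s.pc = 7
  reg4 : s.reg 4 = i
  reg7 : s.reg 7 = D i
  reg9 : s.reg 9 = prefixFreq D (i + 1) (D i)
  reg11 : s.reg 11 = 0
  reg13 : s.reg 13 = 0
  count : ∀ y, s.mem (n + y) = prefixFreq D (i + 1) y
  isPrefixMode : IsPrefixMode D i (s.reg 5) (s.reg 6)

theorem reach_countInv_zero [NeZero N] :
    Reach modeProgram τ (input ε bot D) (CountInv ε bot D 0) 1 := by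
  refine Reach.step rfl (Reach.done ⟨⟨⟨rfl, rfl, rfl, rfl⟩, rfl, rfl, rfl, rfl, rfl, ?_⟩,
    rfl, rfl, rfl, rfl, ?_, isPrefixMode_zero D⟩)
  · exact fun j => dif_pos j.2
  · exact fun y => dif_neg (by omega)

theorem CountInv.reach_counted {i : Fin n} (hs : CountInv ε bot D i s) :
    Reach modeProgram τ s (Counted ε bot D i) 6 := by
  obtain ⟨pc, r, m, x, k⟩ := s
  obtain rfl : pc = 1 := hs.pc
  have hload : m (r 4) = D i := (congrArg m hs.reg4).trans (hs.mem i)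
  have haddr : r 0 + m (r 4) = n + D i := congrArg₂ _ hs.reg0 hload
  have hcount : m (r 0 + m (r 4)) + r 3 = prefixFreq D (i + 1) (D i) := by
    rw [prefixFreq_succ, if_pos rfl, haddr]
    exact congrArg₂ _ (hs.count (D i)) hs.reg3
  refine Reach.jumpLE rfl (fun h : r 0 ≤ r 4 => ?_) fun _ => ?_
  · exact absurd (hs.reg0.ge.trans (h.trans hs.reg4.le)) i.2.not_ge
  iterate 5 refine Reach.step rfl ?_
  refine Reach.done { hs with pc := rfl, reg7 := hload, reg9 := hcount, mem := ?_, count := ?_ }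
  · intro j
    exact (Function.update_of_ne (by change (j : ℕ) ≠ r 0 + m (r 4); omega) _ _).trans (hs.mem j)
  · intro y
    change Function.update m (r 0 + m (r 4)) (m (r 0 + m (r 4)) + r 3) (n + y) = _
    rw [haddr]
    obtain rfl | hy := eq_or_ne (D i : ℕ) y
    · rw [Function.update_self, ← haddr, hcount]
    · rw [Function.update_of_ne (by omega), prefixFreq_succ, if_neg hy, Nat.add_zero]
      exact hs.count y

theorem Counted.reach_countInv {i : Fin n} (hs : Counted ε bot D i s) :
    Reach modeProgram τ s (CountInv ε bot D (i + 1)) 9 := by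
  obtain ⟨pc, r, m, x, k⟩ := s
  obtain rfl : pc = 7 := hs.pc
  have hone : r 3 = 1 := hs.reg3
  have hzero : r 12 = 0 := hs.reg12
  have hcount : r 9 = prefixFreq D (i + 1) (D i) := hs.reg9
  have hitem : r 7 = D i := hs.reg7
  have hnext : r 4 + r 3 = i + 1 := congrArg₂ _ hs.reg4 hs.reg3
  have keep (hle : r 9 ≤ r 6) (hmd : r 9 = r 6 → r 5 ≤ r 7) :
      IsPrefixMode D (i + 1) (r 5) (r 6) :=
    hs.isPrefixMode.succ_of_le (hcount ▸ hle) (hcount ▸ hitem ▸ hmd)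
  have replace {md best : ℕ} (hmd : md = r 7) (hbest : best = r 9) (hle : r 6 ≤ r 9)
      (hmin : r 9 = r 6 → r 7 ≤ r 5) : IsPrefixMode D (i + 1) md best := by
    rw [hmd, hbest, hcount, hitem]
    exact hs.isPrefixMode.succ_of_ge (hcount ▸ hle) (hcount ▸ hitem ▸ hmin)
  refine Reach.jumpLE rfl (fun hle : r 9 ≤ r 6 => ?_) fun hlt : ¬ r 9 ≤ r 6 => ?_
  · refine Reach.step rfl ?_
    refine Reach.jumpLE rfl (fun hlt : r 9 + r 3 ≤ r 6 => ?_) fun hge : ¬ r 9 + r 3 ≤ r 6 => ?_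
    · iterate 2 refine Reach.step rfl ?_
      exact Reach.done { hs with pc := rfl, reg4 := hnext, isPrefixMode := keep hle (by omega) }
    refine Reach.jumpLE rfl (fun hmd : r 5 ≤ r 7 => ?_) fun hmd : ¬ r 5 ≤ r 7 => ?_
    · iterate 2 refine Reach.step rfl ?_
      exact Reach.done { hs with pc := rfl, reg4 := hnext, isPrefixMode := keep hle fun _ => hmd }
    · have hmode : IsPrefixMode D (i + 1) (r 7 + r 12) (r 6) :=
        replace (by omega) (by omega) (by omega) (by omega)
      iterate 3 refine Reach.step rfl ?_
      exact Reach.done { hs with pc := rfl, reg4 := hnext, isPrefixMode := hmode }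
  · have hmode : IsPrefixMode D (i + 1) (r 7 + r 12) (r 9 + r 12) :=
      replace (by omega) (by omega) (by omega) (by omega)
    iterate 3 refine Reach.step rfl ?_
    refine Reach.jumpLE rfl (fun h : r 9 + r 3 ≤ r 9 + r 12 => by omega) fun _ => ?_
    refine Reach.jumpLE rfl (fun _ => ?_) fun h : ¬ r 7 + r 12 ≤ r 7 => by omega
    iterate 2 refine Reach.step rfl ?_
    exact Reach.done { hs with pc := rfl, reg4 := hnext, isPrefixMode := hmode }

theorem CountInv.reach_succ {i : ℕ} (hi : i < n) (hs : CountInv ε bot D i s) :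
    Reach modeProgram τ s (CountInv ε bot D (i + 1)) 15 :=
  (CountInv.reach_counted (i := ⟨i, hi⟩) hs).trans fun _ => Counted.reach_countInv

/-- The invariant of the loop that computes the frequency of the second most frequent item, before
the record `i` is read. -/
structure SecondInv [NeZero N] (ε : ℝ) (bot : Fin N) (D : Fin n → Fin N) (i : ℕ) (s : Config) :
    Prop extends Frame ε bot D s where
  pc : s.pc = 19
  reg4 : s.reg 4 = i
  reg5 : s.reg 5 = mode D
  reg6 : s.reg 6 = occ₁ D
  reg13 : s.reg 13 = 0
  count : ∀ y : Fin N, s.mem (n + y) = if y = mode D then 0 else freq D y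
  le_reg11 : ∀ j : Fin n, j < i → D j ≠ mode D → freq D (D j) ≤ s.reg 11
  reg11_le : s.reg 11 ≤ occ₂ D

theorem CountInv.reach_secondInv [NeZero N] (hs : CountInv ε bot D n s) :
    Reach modeProgram τ s (SecondInv ε bot D 0) 4 := by
  obtain ⟨pc, r, m, x, k⟩ := s
  obtain rfl : pc = 1 := hs.pc
  obtain ⟨hmode, hocc⟩ : r 5 = mode D ∧ r 6 = occ₁ D := hs.isPrefixMode.eq_mode
  have haddr : r 0 + r 5 = n + mode D := congrArg₂ _ hs.reg0 hmode
  refine Reach.jumpLE rfl (fun _ => ?_) fun h => absurd (hs.reg0.trans hs.reg4.symm).le h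
  iterate 3 refine Reach.step rfl ?_
  refine Reach.done { hs with
    pc := rfl
    reg4 := rfl
    reg5 := hmode
    reg6 := hocc
    mem := fun j => ?_
    count := fun y => ?_
    le_reg11 := fun j hj => absurd hj (Nat.not_lt_zero j)
    reg11_le := hs.reg11.trans_le (Nat.zero_le _) }
  · exact (Function.update_of_ne (by change (j : ℕ) ≠ r 0 + r 5; omega) _ _).trans (hs.mem j)
  · change Function.update m (r 0 + r 5) (r 12) (n + y) = _
    rw [haddr]
    obtain rfl | hy := eq_or_ne y (mode D)
    · rw [Function.update_self, if_pos rfl]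
      exact hs.reg12
    · rw [Function.update_of_ne (by simpa [Fin.ext_iff] using hy), if_neg hy, ← prefixFreq_length]
      exact hs.count y

theorem SecondInv.reach_succ [NeZero N] {i : ℕ} (hi : i < n) (hs : SecondInv ε bot D i s) :
    Reach modeProgram τ s (SecondInv ε bot D (i + 1)) 8 := by
  obtain ⟨pc, r, m, x, k⟩ := s
  obtain rfl : pc = 19 := hs.pc
  have hload : m (r 4) = D ⟨i, hi⟩ := (congrArg m hs.reg4).trans (hs.mem ⟨i, hi⟩)
  have hcount : m (r 0 + m (r 4)) =
      if D ⟨i, hi⟩ = mode D then 0 else freq D (D ⟨i, hi⟩) :=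
    (congrArg m (congrArg₂ _ hs.reg0 hload)).trans (hs.count _)
  have hnext : r 4 + r 3 = i + 1 := congrArg₂ _ hs.reg4 hs.reg3
  have hzero : r 12 = 0 := hs.reg12
  have hbound {b : ℕ} (hle : r 11 ≤ b) (hcb : m (r 0 + m (r 4)) ≤ b) (j : Fin n) (hj : j < i + 1)
      (hne : D j ≠ mode D) : freq D (D j) ≤ b := by
    obtain hj | hj := Nat.lt_succ_iff_lt_or_eq.1 hj
    · exact (hs.le_reg11 j hj hne).trans hle
    · obtain rfl : j = ⟨i, hi⟩ := Fin.ext hj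
      rwa [hcount, if_neg hne] at hcb
  refine Reach.jumpLE rfl (fun h : r 0 ≤ r 4 => ?_) fun _ => ?_
  · exact absurd (hs.reg0.ge.trans (h.trans hs.reg4.le)) hi.not_ge
  iterate 3 refine Reach.step rfl ?_
  refine Reach.jumpLE rfl (fun hle : m (r 0 + m (r 4)) ≤ r 11 => ?_)
    fun hlt : ¬ m (r 0 + m (r 4)) ≤ r 11 => ?_
  · iterate 2 refine Reach.step rfl ?_
    exact Reach.done { hs with pc := rfl, reg4 := hnext, le_reg11 := hbound le_rfl hle }
  · have hne : D ⟨i, hi⟩ ≠ mode D := fun h => by rw [hcount, if_pos h] at hlt; omega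
    have hsecond : m (r 0 + m (r 4)) + r 12 ≤ occ₂ D := by
      rw [hzero, hcount, if_neg hne]
      exact freq_le_occ₂ hne
    iterate 3 refine Reach.step rfl ?_
    exact Reach.done { hs with
      pc := rfl
      reg4 := hnext
      le_reg11 := hbound (b := m (r 0 + m (r 4)) + r 12) (by omega) (by omega)
      reg11_le := hsecond }

theorem SecondInv.reg11_eq [NeZero N] (hs : SecondInv ε bot D n s) : s.reg 11 = occ₂ D := by
  refine hs.reg11_le.antisymm (Finset.sup_le fun y hy => ?_)
  obtain h | ⟨j, hj⟩ := Finset.eq_empty_or_nonempty (Finset.univ.filter fun i => D i = y)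
  · exact (Finset.card_eq_zero.2 h).trans_le (Nat.zero_le _)
  · obtain rfl : D j = y := (Finset.mem_filter.1 hj).2
    exact hs.le_reg11 j j.2 (Finset.ne_of_mem_erase hy)

end Frequencies

/-! ### Correctness of the program: the distance-to-instability test -/

section Test

variable {n N : ℕ} [NeZero N] {ε : ℝ} {bot : Fin N} {D : Fin n → Fin N} {τ : Tape} {s : Config}

/-- The invariant of the loop that computes the number of bits. -/
structure BitsInv (ε : ℝ) (bot : Fin N) (D : Fin n → Fin N) (i : ℕ) (s : Config) : Prop
    extends Frame ε bot D s where
  pc : s.pc = 28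
  reg5 : s.reg 5 = mode D
  reg6 : s.reg 6 = occ₁ D
  reg11 : s.reg 11 = occ₂ D
  reg13 : s.reg 13 = i
  reg14 : s.reg 14 = 2 ^ i

theorem SecondInv.reach_bitsInv (hs : SecondInv ε bot D n s) :
    Reach modeProgram τ s (BitsInv ε bot D 0) 2 := by
  obtain ⟨pc, r, m, x, k⟩ := s
  obtain rfl : pc = 19 := hs.pc
  refine Reach.jumpLE rfl (fun _ => ?_) fun h => absurd (hs.reg0.trans hs.reg4.symm).le h
  refine Reach.step rfl ?_
  exact Reach.done { hs with pc := rfl, reg11 := hs.reg11_eq, reg14 := rfl }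

theorem BitsInv.reach_succ {i : ℕ} (hi : i < bits N) (hs : BitsInv ε bot D i s) :
    Reach modeProgram τ s (BitsInv ε bot D (i + 1)) 4 := by
  obtain ⟨pc, r, m, x, k⟩ := s
  obtain rfl : pc = 28 := hs.pc
  have hpow : 2 ^ i < N := (Nat.lt_clog_iff_pow_lt one_lt_two).1 hi
  have hdouble : r 14 + r 14 = 2 ^ (i + 1) :=
    (congrArg₂ _ hs.reg14 hs.reg14).trans (by rw [pow_succ, mul_two])
  refine Reach.jumpLE rfl (fun h : r 1 ≤ r 14 => ?_) fun _ => ?_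
  · exact absurd (hs.reg1.ge.trans (h.trans hs.reg14.le)) hpow.not_ge
  iterate 3 refine Reach.step rfl ?_
  exact Reach.done { hs with
    pc := rfl
    reg13 := congrArg₂ _ hs.reg13 hs.reg3
    reg14 := hdouble }

theorem instabilityDist_eq (D : Fin n → Fin N) :
    instabilityDist D = ((occ₁ D - occ₂ D + 1) / 2 : ℕ) := by
  obtain ⟨g, hg⟩ := Nat.exists_eq_add_of_le (occ₂_le_occ₁ D)
  have hle : 2 * (((g + 1) / 2 : ℕ) : ℝ) ≤ g + 1 := by
    exact_mod_cast (by omega : 2 * ((g + 1) / 2) ≤ g + 1)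
  have hge : (g : ℝ) ≤ 2 * ((g + 1) / 2 : ℕ) := by
    exact_mod_cast (by omega : g ≤ 2 * ((g + 1) / 2))
  rw [instabilityDist, hg, Int.ceil_eq_iff, Nat.add_sub_cancel_left, Int.cast_natCast,
    Nat.cast_add, add_sub_cancel_left]
  constructor <;> linarith

/-- The output of the distance-to-instability test with noise `z`. -/
noncomputable def testedMode (ε : ℝ) (bot : Fin N) (D : Fin n → Fin N) (z : ℝ) : Fin N :=
  if (instabilityDist D : ℝ) - 1 + z ≤ logInvDelta N ε / ε then bot else mode D

/-- The test has been performed, with outcome `u`. -/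
structure Tested (bot u : Fin N) (s : Config) : Prop extends Consts bot s where
  pc : s.pc = 53
  reg13 : s.reg 13 = bits N
  reg14 : s.reg 14 = 2 ^ bits N
  reg15 : s.reg 15 = u
  reg17 : s.reg 17 = 0
  xreg1 : s.xreg 1 = bits N
  xreg2 : s.xreg 2 = 1
  xreg3 : s.xreg 3 = 2
  xreg9 : s.xreg 9 = 0
  draws : s.draws = 1

theorem BitsInv.reach_tested (hs : BitsInv ε bot D (bits N) s) :
    Reach modeProgram τ s (Tested bot (testedMode ε bot D ((τ 0).2 / ε))) 22 := by
  obtain ⟨pc, r, m, x, k⟩ := s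
  obtain rfl : pc = 28 := hs.pc
  obtain rfl : k = 0 := hs.draws
  have hone : ((r 3 : ℕ) : ℝ) = 1 := (congrArg Nat.cast hs.reg3).trans Nat.cast_one
  have hbits : ((r 13 : ℕ) : ℝ) = bits N := congrArg Nat.cast hs.reg13
  have htwo : ((r 3 : ℕ) : ℝ) + (r 3 : ℕ) = 2 := by rw [hone, one_add_one_eq_two]
  have hdist : (((r 6 - r 11 + r 3) / 2 : ℕ) : ℝ) = instabilityDist D := by
    have hreg : r 6 - r 11 + r 3 = occ₁ D - occ₂ D + 1 :=
      congrArg₂ _ (congrArg₂ _ hs.reg6 hs.reg11) hs.reg3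
    rw [instabilityDist_eq, Int.cast_natCast, hreg]
  have hstat : (((r 6 - r 11 + r 3) / 2 : ℕ) : ℝ) - (r 3 : ℕ) + (τ 0).2 / x 0 =
      instabilityDist D - 1 + (τ 0).2 / ε := by
    rw [hdist, hone, show x 0 = ε from hs.xreg0]
  have hthr : ((r 13 : ℕ) : ℝ) * Real.log
      ((((r 3 : ℕ) : ℝ) + (r 3 : ℕ)) * ((r 13 : ℕ) * (r 13 : ℕ) * (r 13 : ℕ)) / x 0) / x 0 =
      logInvDelta N ε / ε := by
    rw [htwo, hbits, show x 0 = ε from hs.xreg0, logInvDelta, pow_three']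
  have hbot : r 2 + r 12 = bot := congrArg₂ _ hs.reg2 hs.reg12
  have hmode : r 5 + r 12 = mode D := congrArg₂ _ hs.reg5 hs.reg12
  refine Reach.jumpLE rfl (fun _ => ?_) fun h : ¬ r 1 ≤ r 14 =>
    absurd (hs.reg1.le.trans ((le_two_pow_bits N).trans hs.reg14.ge)) h
  iterate 19 refine Reach.step rfl ?_
  refine Reach.jumpLER rfl (fun h => Reach.done ?_) fun h => Reach.step rfl (Reach.done ?_)
  · rw [testedMode, if_pos (hstat.ge.trans (h.trans hthr.le))]
    exact { hs with
      pc := rfl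
      reg15 := hbot
      xreg1 := hbits
      xreg2 := hone
      xreg3 := htwo
      draws := rfl }
  · rw [testedMode, if_neg fun hle => h (hstat.le.trans (hle.trans hthr.ge))]
    exact { hs with
      pc := rfl
      reg15 := hmode
      xreg1 := hbits
      xreg2 := hone
      xreg3 := htwo
      draws := rfl }

end Test

/-! ### Correctness of the program: noise and rounding -/

section Rounding

variable {N : ℕ} {bot u : Fin N} {τ : Tape} {s : Config} {i : ℕ}

/-- The `j`-th coordinate of the point drawn from the mixture, as computed from the tape. -/
noncomputable def mixturePoint (u : Fin N) (τ : Tape) (j : ℕ) : ℝ :=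
  if (τ 1).1 ≤ 2⁻¹ ^ bits N then (τ (2 * j + 2)).1 else if (u : ℕ).testBit j then 1 else 0

/-- The `j`-th output bit, as computed from the tape. -/
noncomputable def noisyBit (u : Fin N) (τ : Tape) (j : ℕ) : Bool :=
  decide (1 / 2 ≤ mixturePoint u τ j + noiseScale (bits N) * (τ (2 * j + 3)).2)

/-- The contents of the registers that do not change while the bit `i` is processed. -/
structure RoundFrame (bot u : Fin N) (τ : Tape) (i : ℕ) (s : Config) : Prop
    extends Consts bot s where
  reg4 : s.reg 4 = i
  reg13 : s.reg 13 = bits N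
  reg16 : s.reg 16 = if (τ 1).1 ≤ 2⁻¹ ^ bits N then 1 else 0
  reg17 : s.reg 17 = ∑ j ∈ Finset.range i, (noisyBit u τ j).toNat * 2 ^ j
  reg18 : s.reg 18 = 2 ^ i
  xreg7 : s.xreg 7 = noiseScale (bits N)
  xreg11 : s.xreg 11 = 1 / 2

/-- The invariant of the rounding loop, before the bit `i` is processed. -/
structure RoundInv (bot u : Fin N) (τ : Tape) (i : ℕ) (s : Config) : Prop
    extends RoundFrame bot u τ i s where
  pc : s.pc = 70
  reg15 : s.reg 15 = u / 2 ^ i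
  draws : s.draws = 2 * i + 2

/-- The coordinate `i` of the point and its noise have been drawn, but not yet rounded. -/
structure Sampled (bot u : Fin N) (τ : Tape) (i : ℕ) (s : Config) : Prop
    extends RoundFrame bot u τ i s where
  pc : s.pc = 78
  reg8 : s.reg 8 = u / 2 ^ (i + 1)
  xreg5 : s.xreg 5 = (τ (2 * i + 3)).2
  xreg6 : s.xreg 6 = mixturePoint u τ i
  draws : s.draws = 2 * i + 4

theorem noiseScale_eq_exp (d : ℕ) :
    noiseScale d = (2 + 2) * (Real.exp (0 - Real.log 2 / d) / d / d) := by
  rw [noiseScale, Real.rpow_def_of_pos two_pos, zero_sub, div_div, ← pow_two, mul_div_assoc]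
  norm_num [div_eq_mul_inv]

theorem Tested.reach_roundInv (hs : Tested bot u s) :
    Reach modeProgram τ s (RoundInv bot u τ 0) 17 := by
  obtain ⟨pc, r, m, x, k⟩ := s
  obtain rfl : pc = 53 := hs.pc
  obtain rfl : k = 1 := hs.draws
  have hweight : x 2 / (r 14 : ℕ) = 2⁻¹ ^ bits N := by
    rw [show x 2 = 1 from hs.xreg2, show r 14 = 2 ^ bits N from hs.reg14]
    simp only [Nat.cast_pow, Nat.cast_ofNat, one_div, inv_pow]
  have hscale : (x 3 + x 3) * (Real.exp (x 9 - Real.log (x 3) / x 1) / x 1 / x 1) =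
      noiseScale (bits N) := by
    rw [noiseScale_eq_exp, show x 3 = 2 from hs.xreg3, show x 9 = 0 from hs.xreg9,
      show x 1 = bits N from hs.xreg1]
  have hhalf : x 2 / x 3 = 1 / 2 := congrArg₂ _ hs.xreg2 hs.xreg3
  have hrest : r 15 = u / 2 ^ 0 := hs.reg15.trans (Nat.div_one _).symm
  have hword : r 17 = ∑ j ∈ Finset.range 0, (noisyBit u τ j).toNat * 2 ^ j :=
    hs.reg17.trans (Finset.sum_range_zero _).symm
  iterate 13 refine Reach.step rfl ?_
  refine Reach.jumpLER rfl (fun h => ?_) fun h => ?_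
  · iterate 2 refine Reach.step rfl ?_
    exact Reach.done { hs with
      pc := rfl
      reg4 := rfl
      reg15 := hrest
      reg16 := (if_pos (h.trans hweight.le)).symm
      reg17 := hword
      reg18 := rfl
      xreg7 := hscale
      xreg11 := hhalf
      draws := rfl }
  · iterate 3 refine Reach.step rfl ?_
    exact Reach.done { hs with
      pc := rfl
      reg4 := rfl
      reg15 := hrest
      reg16 := (if_neg fun hle => h (hle.trans hweight.ge)).symm
      reg17 := hword
      reg18 := rfl
      xreg7 := hscale
      xreg11 := hhalf
      draws := rfl }

theorem sub_half_add_half (a : ℕ) : a - (a / 2 + a / 2) = (a.testBit 0).toNat := by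
  rw [Nat.testBit_zero]
  obtain h | h := Nat.mod_two_eq_zero_or_one a <;> simp only [h] <;> simp <;> omega

theorem RoundInv.reach_sampled (hi : i < bits N) (hs : RoundInv bot u τ i s) :
    Reach modeProgram τ s (Sampled bot u τ i) 8 := by
  obtain ⟨pc, r, m, x, k⟩ := s
  obtain rfl : pc = 70 := hs.pc
  obtain rfl : k = 2 * i + 2 := hs.draws
  have hrest : r 15 / 2 = u / 2 ^ (i + 1) := by
    rw [show r 15 = u / 2 ^ i from hs.reg15, Nat.div_div_eq_div_mul, pow_succ]
  have hbit : r 15 - (r 15 / 2 + r 15 / 2) = ((u : ℕ).testBit i).toNat := by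
    rw [sub_half_add_half, show r 15 = u / 2 ^ i from hs.reg15, Nat.testBit_div_two_pow, zero_add]
  have hflag : r 3 ≤ r 16 ↔ (τ 1).1 ≤ 2⁻¹ ^ bits N := by
    rw [show r 3 = 1 from hs.reg3, show r 16 = _ from hs.reg16]
    split_ifs with h
    exacts [iff_of_true le_rfl h, iff_of_false one_pos.not_ge h]
  refine Reach.jumpLE rfl (fun h : r 13 ≤ r 4 => ?_) fun _ => ?_
  · exact absurd (hs.reg13.ge.trans (h.trans hs.reg4.le)) hi.not_ge
  iterate 5 refine Reach.step rfl ?_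
  refine Reach.jumpLE rfl (fun h : r 3 ≤ r 16 => Reach.done ?_)
    fun h : ¬ r 3 ≤ r 16 => Reach.step rfl (Reach.done ?_)
  · exact { hs with
      pc := rfl
      reg8 := hrest
      xreg5 := rfl
      xreg6 := (if_pos (hflag.1 h)).symm
      draws := rfl }
  · have hpoint : ((r 15 - (r 15 / 2 + r 15 / 2) : ℕ) : ℝ) = mixturePoint u τ i := by
      rw [mixturePoint, if_neg (hflag.not.1 h), hbit, Bool.toNat, Bool.cond_eq_ite, Nat.cast_ite,
        Nat.cast_one, Nat.cast_zero]
    exact { hs with pc := rfl, reg8 := hrest, xreg5 := rfl, xreg6 := hpoint, draws := rfl }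

theorem Sampled.reach_roundInv (hs : Sampled bot u τ i s) :
    Reach modeProgram τ s (RoundInv bot u τ (i + 1)) 8 := by
  obtain ⟨pc, r, m, x, k⟩ := s
  obtain rfl : pc = 78 := hs.pc
  obtain rfl : k = 2 * i + 4 := hs.draws
  have hbit : noisyBit u τ i = decide (x 11 ≤ x 6 + x 7 * x 5) := by
    rw [noisyBit, show x 11 = 1 / 2 from hs.xreg11, show x 6 = _ from hs.xreg6,
      show x 7 = _ from hs.xreg7, show x 5 = _ from hs.xreg5]
  have hword : r 17 + (noisyBit u τ i).toNat * r 18 =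
      ∑ j ∈ Finset.range (i + 1), (noisyBit u τ j).toNat * 2 ^ j := by
    rw [Finset.sum_range_succ, show r 17 = _ from hs.reg17, show r 18 = _ from hs.reg18]
  have hpow : r 18 + r 18 = 2 ^ (i + 1) :=
    (congrArg₂ _ hs.reg18 hs.reg18).trans (by rw [pow_succ, mul_two])
  have hnext : r 4 + r 3 = i + 1 := congrArg₂ _ hs.reg4 hs.reg3
  have hrest : r 8 + r 12 = u / 2 ^ (i + 1) := congrArg₂ _ hs.reg8 hs.reg12
  iterate 3 refine Reach.step rfl ?_
  refine Reach.jumpLER rfl (fun h : x 11 ≤ x 6 + x 7 * x 5 => ?_)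
    fun h : ¬ x 11 ≤ x 6 + x 7 * x 5 => ?_
  · rw [hbit, decide_eq_true h, Bool.toNat_true, one_mul] at hword
    iterate 4 refine Reach.step rfl ?_
    exact Reach.done { hs with
      pc := rfl, reg4 := hnext, reg15 := hrest, reg17 := hword, reg18 := hpow, draws := rfl }
  · rw [hbit, decide_eq_false h, Bool.toNat_false, zero_mul] at hword
    iterate 4 refine Reach.step rfl ?_
    exact Reach.done { hs with
      pc := rfl, reg4 := hnext, reg15 := hrest, reg17 := hword, reg18 := hpow, draws := rfl }

theorem RoundInv.reach_succ (hi : i < bits N) (hs : RoundInv bot u τ i s) :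
    Reach modeProgram τ s (RoundInv bot u τ (i + 1)) 16 :=
  (hs.reach_sampled hi).trans fun _ => Sampled.reach_roundInv

theorem ofBits_eq_sum {d : ℕ} (g : ℕ → Bool) :
    Nat.ofBits (fun j : Fin d => g j) = ∑ j ∈ Finset.range d, (g j).toNat * 2 ^ j := by
  induction d generalizing g with
  | zero => rfl
  | succ d ih =>
    have htail := ih fun j => g (j + 1)
    simp only [Nat.ofBits_succ, Finset.sum_range_succ', Function.comp_def, Fin.val_succ,
      Fin.val_zero, pow_zero, mul_one, htail, Finset.mul_sum, pow_succ]
    simp only [mul_comm, mul_left_comm]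

theorem RoundInv.reach_halted (hs : RoundInv bot u τ (bits N) s) :
    Reach modeProgram τ s (fun s' => Halted modeProgram s' ∧
      s'.reg 0 = decode bot fun j : Fin (bits N) => noisyBit u τ j) 4 := by
  obtain ⟨pc, r, m, x, k⟩ := s
  obtain rfl : pc = 70 := hs.pc
  have hword : r 17 = Nat.ofBits fun j : Fin (bits N) => noisyBit u τ j :=
    hs.reg17.trans (ofBits_eq_sum _).symm
  have hbound : r 1 ≤ r 17 ↔ ¬ r 17 < N := by rw [show r 1 = N from hs.reg1, not_lt]
  have hbot : r 2 + r 12 = bot := congrArg₂ _ hs.reg2 hs.reg12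
  have hout : r 17 + r 12 = r 17 := congrArg _ hs.reg12
  refine Reach.jumpLE rfl (fun _ => ?_) fun h => absurd (hs.reg13.trans hs.reg4.symm).le h
  refine Reach.step rfl ?_
  refine Reach.jumpLE rfl (fun h : r 1 ≤ r 17 => Reach.done ⟨le_rfl, ?_⟩)
    fun h : ¬ r 1 ≤ r 17 => Reach.step rfl (Reach.done ⟨le_rfl, ?_⟩)
  · rw [decode, dif_neg (hword ▸ hbound.1 h)]
    exact hbot
  · rw [decode, dif_pos (hword ▸ not_not.1 (hbound.not.1 h))]
    exact hout.trans hword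

end Rounding

section Program

variable {n N : ℕ} [NeZero N] {ε : ℝ} {bot : Fin N} {D : Fin n → Fin N} {τ : Tape}

theorem reach_modeProgram :
    Reach modeProgram τ (input ε bot D) (fun s => Halted modeProgram s ∧
      s.reg 0 = decode bot fun j : Fin (bits N) =>
        noisyBit (testedMode ε bot D ((τ 0).2 / ε)) τ j)
      (1 + n * 15 + 4 + n * 8 + 2 + bits N * 4 + 22 + 17 + bits N * 16 + 4) :=
  reach_countInv_zero
    |>.trans (fun _ => Reach.loop fun _ hi _ => CountInv.reach_succ hi)
    |>.trans (fun _ => CountInv.reach_secondInv)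
    |>.trans (fun _ => Reach.loop fun _ hi _ => SecondInv.reach_succ hi)
    |>.trans (fun _ => SecondInv.reach_bitsInv)
    |>.trans (fun _ => Reach.loop fun _ hi _ => BitsInv.reach_succ hi)
    |>.trans (fun _ => BitsInv.reach_tested)
    |>.trans (fun _ => Tested.reach_roundInv)
    |>.trans (fun _ => Reach.loop fun _ hi _ => RoundInv.reach_succ hi)
    |>.trans (fun _ => RoundInv.reach_halted)

theorem run_modeProgram (hN : 2 ≤ N) (ε : ℝ) (bot : Fin N) (D : Fin n → Fin N) (τ : Tape) :
    Halted modeProgram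
        (run modeProgram τ (input ε bot D) ⌊(210 : ℝ) * (n + Real.log N)⌋₊) ∧
      (run modeProgram τ (input ε bot D) ⌊(210 : ℝ) * (n + Real.log N)⌋₊).reg 0 =
        decode bot fun j : Fin (bits N) =>
          noisyBit (testedMode ε bot D ((τ 0).2 / ε)) τ j := by
  obtain ⟨t, ht, hhalt, hout⟩ := reach_modeProgram (τ := τ) (ε := ε) (bot := bot) (D := D)
  have hle : t ≤ ⌊(210 : ℝ) * (n + Real.log N)⌋₊ := by
    refine Nat.le_floor ?_
    have hcost : (t : ℝ) ≤
        1 + n * 15 + 4 + n * 8 + 2 + bits N * 4 + 22 + 17 + bits N * 16 + 4 := by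
      exact_mod_cast ht
    have hbits := bits_le_three_mul_log hN
    have hbits_one : (1 : ℝ) ≤ bits N := by exact_mod_cast bits_pos hN
    have : (0 : ℝ) ≤ n := Nat.cast_nonneg n
    linarith
  rw [run_of_halted hle hhalt]
  exact ⟨hhalt, hout⟩

end Program

/-! ### The law of the output of the program -/

/-- The uniform distribution on the unit interval, the law of the first entries of the tape. -/
noncomputable abbrev unitUniform : Measure ℝ := volume.restrict (Set.Icc 0 1)

instance : IsProbabilityMeasure unitUniform := ⟨by simp⟩

instance : IsProbabilityMeasure (laplace 1) := isProbabilityMeasure_laplace one_pos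

theorem measurePreserving_pi_of_injective {ι : Type*} [Fintype ι] {f : ι → ℕ}
    (hf : Function.Injective f) {g : ι → ℝ × ℝ → ℝ} {ρ : ι → Measure ℝ}
    (hg : ∀ i, MeasurePreserving (g i) (unitUniform.prod (laplace 1)) (ρ i)) :
    MeasurePreserving (fun (τ : Tape) i => g i (τ (f i))) tapeLaw (Measure.pi ρ) := by
  have hentries : MeasurePreserving (fun (τ : Tape) i => τ (f i)) tapeLaw
      (Measure.pi fun _ : ι => unitUniform.prod (laplace 1)) := by
    refine ⟨by fun_prop, ?_⟩
    rw [tapeLaw, Measure.map_infinitePi_infinitePi_of_inj hf, Measure.infinitePi_eq_pi]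
  have hρ (i : ι) : IsProbabilityMeasure (ρ i) := by
    rw [← (hg i).map_eq]
    exact Measure.isProbabilityMeasure_map (hg i).measurable.aemeasurable
  exact (measurePreserving_pi _ _ hg).comp hentries

section ReadTape

variable (d : ℕ)

/-- The numbers on the tape that the program reads for `d` bits: the noise of the stability test,
the uniform number that selects the mixture component, the uniform point of the cube, and the noise
added to the coordinates. -/
def readTape (τ : Tape) : (ℝ × ℝ × (Fin d → ℝ)) × (Fin d → ℝ) :=
  (((τ 0).2, (τ 1).1, fun j => (τ (2 * j + 2)).1), fun j => (τ (2 * j + 3)).2)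

/-- The positions on the tape of the numbers in `readTape`, in the same order. -/
def tapeIndex : (Unit ⊕ (Unit ⊕ Fin d)) ⊕ Fin d → ℕ :=
  Sum.elim (Sum.elim (fun _ => 0) (Sum.elim (fun _ => 1) fun j => 2 * j + 2)) fun j => 2 * j + 3

theorem tapeIndex_injective : Function.Injective (tapeIndex d) := by
  rintro ((_ | _ | i) | i) ((_ | _ | j) | j) h <;>
    simp only [tapeIndex, Sum.elim_inl, Sum.elim_inr] at h <;>
    grind

theorem measurePreserving_readTape :
    MeasurePreserving (readTape d) tapeLaw
      (((laplace 1).prod (unitUniform.prod (Measure.pi fun _ : Fin d => unitUniform))).prod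
        (Measure.pi fun _ : Fin d => laplace 1)) := by
  let g : (Unit ⊕ (Unit ⊕ Fin d)) ⊕ Fin d → ℝ × ℝ → ℝ :=
    Sum.elim (Sum.elim (fun _ => Prod.snd) (Sum.elim (fun _ => Prod.fst) fun _ => Prod.fst))
      fun _ => Prod.snd
  let ρ : (Unit ⊕ (Unit ⊕ Fin d)) ⊕ Fin d → Measure ℝ :=
    Sum.elim (Sum.elim (fun _ => laplace 1) (Sum.elim (fun _ => unitUniform) fun _ => unitUniform))
      fun _ => laplace 1
  have hg (i) : MeasurePreserving (g i) (unitUniform.prod (laplace 1)) (ρ i) := by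
    rcases i with (_ | _ | _) | _
    exacts [measurePreserving_snd, measurePreserving_fst, measurePreserving_fst,
      measurePreserving_snd]
  have hρ (i) : IsProbabilityMeasure (ρ i) := by
    rcases i with (_ | _ | _) | _ <;> simp only [ρ, Sum.elim_inl, Sum.elim_inr] <;> infer_instance
  have hunit (μ : Measure ℝ) : MeasurePreserving (MeasurableEquiv.funUnique Unit ℝ)
      (Measure.pi fun _ : Unit => μ) μ := measurePreserving_funUnique μ Unit
  have hsplit := measurePreserving_sumPiEquivProdPi (X := fun _ => ℝ) ρ
  have hsplit_left := measurePreserving_sumPiEquivProdPi (X := fun _ => ℝ) fun i => ρ (.inl i)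
  have hsplit_cube := measurePreserving_sumPiEquivProdPi (X := fun _ => ℝ)
    fun i => ρ (.inl (.inr i))
  have hcube := ((hunit unitUniform).prod (.id (Measure.pi fun _ : Fin d => unitUniform))).comp
    hsplit_cube
  have hleft := ((hunit (laplace 1)).prod hcube).comp hsplit_left
  exact ((hleft.prod (.id (Measure.pi fun _ : Fin d => laplace 1))).comp hsplit).comp
    (measurePreserving_pi_of_injective (tapeIndex_injective d) hg)

theorem pi_unitUniform :
    (Measure.pi fun _ : Fin d => unitUniform) = volume.restrict (Set.Icc 0 1) := by
  rw [← Set.pi_univ_Icc, volume_pi, Measure.restrict_pi_pi]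
  rfl

theorem pi_laplace_eq_map {b : ℝ} (hb : 0 < b) :
    (Measure.pi fun _ : Fin d => laplace b) =
      (Measure.pi fun _ : Fin d => laplace 1).map fun l j => b * l j := by
  have := isProbabilityMeasure_laplace hb
  have hscale : MeasurePreserving (fun x : ℝ => b * x) (laplace 1) (laplace b) :=
    ⟨by fun_prop, (laplace_eq_map_mul hb).symm⟩
  exact (measurePreserving_pi _ _ fun _ : Fin d => hscale).map_eq.symm

end ReadTape

theorem unitUniform_Iic {a : ℝ} (ha : a ≤ 1) : unitUniform (Set.Iic a) = ENNReal.ofReal a := by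
  have hinter : Set.Iic a ∩ Set.Icc 0 1 = Set.Icc 0 a := by
    rw [← Set.Ici_inter_Iic, Set.inter_left_comm, Set.Iic_inter_Iic, inf_eq_left.2 ha,
      Set.Ici_inter_Iic]
  rw [Measure.restrict_apply measurableSet_Iic, hinter, Real.volume_Icc, sub_zero]

theorem unitUniform_Ioi {a : ℝ} (ha₀ : 0 ≤ a) (ha₁ : a ≤ 1) :
    unitUniform (Set.Ioi a) = ENNReal.ofReal (1 - a) := by
  rw [← Set.compl_Iic, prob_compl_eq_one_sub measurableSet_Iic, unitUniform_Iic ha₁,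
    ENNReal.ofReal_sub 1 ha₀, ENNReal.ofReal_one]

section Mixture

variable {α β : Type*} [MeasurableSpace α] [MeasurableSpace β] {φ : α → β}

theorem measurable_mixture (hφ : Measurable φ) (ω : ℝ) :
    Measurable fun p : α × ℝ × β => if p.2.1 ≤ ω then p.2.2 else φ p.1 :=
  Measurable.ite (measurableSet_le (by fun_prop) measurable_const) (by fun_prop) (by fun_prop)

theorem map_mixture (hφ : Measurable φ) {ω : ℝ} (hω₀ : 0 ≤ ω) (hω₁ : ω ≤ 1) (μ : Measure α)
    (ν : Measure β) [IsProbabilityMeasure μ] [IsProbabilityMeasure ν] :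
    (μ.prod (unitUniform.prod ν)).map (fun p => if p.2.1 ≤ ω then p.2.2 else φ p.1) =
      ENNReal.ofReal (1 - ω) • μ.map φ + ENNReal.ofReal ω • ν := by
  ext s hs
  have hpreimage : (fun p : α × ℝ × β => if p.2.1 ≤ ω then p.2.2 else φ p.1) ⁻¹' s =
      (φ ⁻¹' s) ×ˢ (Set.Ioi ω ×ˢ Set.univ) ∪ Set.univ ×ˢ (Set.Iic ω ×ˢ s) := by
    ext ⟨z, a, v⟩
    by_cases h : a ≤ ω <;> simp [h, not_le.1]
  have hdisjoint : Disjoint ((φ ⁻¹' s) ×ˢ (Set.Ioi ω ×ˢ (Set.univ : Set β)))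
      (Set.univ ×ˢ (Set.Iic ω ×ˢ s)) := by
    rw [Set.disjoint_left]
    rintro ⟨z, a, v⟩ ⟨-, ha, -⟩ ⟨-, ha', -⟩
    exact (Set.mem_Ioi.1 ha).not_ge ha'
  rw [Measure.map_apply (measurable_mixture hφ ω) hs, hpreimage,
    measure_union hdisjoint (MeasurableSet.univ.prod (measurableSet_Iic.prod hs))]
  simp only [Measure.prod_prod, unitUniform_Ioi hω₀ hω₁, unitUniform_Iic hω₁, measure_univ,
    one_mul, Measure.add_apply, Measure.smul_apply, smul_eq_mul, Measure.map_apply hφ hs,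
    mul_comm]

end Mixture

section Law

variable {n N : ℕ} [NeZero N] {ε : ℝ}

theorem approxMode_eq_map (hε : 0 < ε) (bot : Fin N) (D : Fin n → Fin N) :
    approxMode ε bot D = (laplace 1).map fun z => testedMode ε bot D (z / ε) := by
  rw [approxMode, laplace_eq_map_mul (b := 1 / ε) (by positivity),
    Measure.map_map (measurable_test ε bot D) (by fun_prop)]
  congr 1
  ext z
  simp only [testedMode, Function.comp_apply, one_div_mul_eq_div]

variable (ε) (bot : Fin N) (D : Fin n → Fin N)

theorem measurable_binMap_testedMode :
    Measurable fun z : ℝ => binMap (testedMode ε bot D (z / ε)) :=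
  (measurable_of_finite binMap).comp
    ((measurable_test ε bot D).comp (measurable_id.div_const ε))

/-- A draw from `cubeMixture (approxMode ε bot D)` as a function of standard random numbers: the
test noise, the selector of the mixture component and the uniform point. -/
noncomputable def mixtureDraw (p : ℝ × ℝ × (Fin (bits N) → ℝ)) : Fin (bits N) → ℝ :=
  if p.2.1 ≤ 2⁻¹ ^ bits N then p.2.2 else binMap (testedMode ε bot D (p.1 / ε))

/-- The released element as a function of standard random numbers: those of `mixtureDraw` and the
unscaled noise of the coordinates. -/
noncomputable def releaseDraw (q : (ℝ × ℝ × (Fin (bits N) → ℝ)) × (Fin (bits N) → ℝ)) : Fin N :=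
  decode bot (roundCube (mixtureDraw ε bot D q.1 + fun j => noiseScale (bits N) * q.2 j))

variable {ε}

theorem measurePreserving_mixtureDraw (hε : 0 < ε) :
    MeasurePreserving (mixtureDraw ε bot D)
      ((laplace 1).prod (unitUniform.prod (Measure.pi fun _ => unitUniform)))
      (cubeMixture (approxMode ε bot D)) := by
  have hφ := measurable_binMap_testedMode ε bot D
  have htest : Measurable fun z : ℝ => testedMode ε bot D (z / ε) :=
    (measurable_test ε bot D).comp (measurable_id.div_const ε)
  refine ⟨measurable_mixture hφ _, ?_⟩
  rw [cubeMixture, ← pi_unitUniform, approxMode_eq_map hε,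
    Measure.map_map (measurable_of_finite binMap) htest]
  exact map_mixture hφ (by positivity) (pow_le_one₀ (by norm_num) (by norm_num)) _ _

theorem measurePreserving_releaseDraw (hN : 2 ≤ N) (hε : 0 < ε) :
    MeasurePreserving (releaseDraw ε bot D)
      (((laplace 1).prod (unitUniform.prod (Measure.pi fun _ => unitUniform))).prod
        (Measure.pi fun _ => laplace 1)) (modeRelease ε bot D) := by
  have hb := noiseScale_pos (bits_pos hN)
  have := isProbabilityMeasure_laplace hb
  have := isProbabilityMeasure_approxMode hε bot D
  have hnoise : MeasurePreserving (fun (l : Fin (bits N) → ℝ) j => noiseScale (bits N) * l j)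
      (Measure.pi fun _ => laplace 1) (Measure.pi fun _ => laplace (noiseScale (bits N))) :=
    ⟨by fun_prop, (pi_laplace_eq_map _ hb).symm⟩
  have hdecode : MeasurePreserving (fun z => decode bot (roundCube z))
      (cubeMixture (approxMode ε bot D) ∗ Measure.pi fun _ => laplace (noiseScale (bits N)))
      (modeRelease ε bot D) :=
    ⟨measurable_decode_roundCube bot, (modeRelease_eq_map hN hε bot D).symm⟩
  have hadd : MeasurePreserving (fun p : (Fin (bits N) → ℝ) × (Fin (bits N) → ℝ) => p.1 + p.2)
      ((cubeMixture (approxMode ε bot D)).prod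
        (Measure.pi fun _ => laplace (noiseScale (bits N)))) _ := ⟨by fun_prop, rfl⟩
  exact hdecode.comp (hadd.comp ((measurePreserving_mixtureDraw bot D hε).prod hnoise))

theorem decode_noisyBit_eq_releaseDraw (ε : ℝ) (τ : Tape) :
    (decode bot fun j : Fin (bits N) => noisyBit (testedMode ε bot D ((τ 0).2 / ε)) τ j) =
      releaseDraw ε bot D (readTape (bits N) τ) := by
  have hpoint (j : Fin (bits N)) : mixturePoint (testedMode ε bot D ((τ 0).2 / ε)) τ j =
      mixtureDraw ε bot D (readTape (bits N) τ).1 j :=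
    (ite_apply ((τ 1).1 ≤ 2⁻¹ ^ bits N) (fun j : Fin (bits N) => (τ (2 * j + 2)).1)
      (binMap (testedMode ε bot D ((τ 0).2 / ε))) j).symm
  simp only [noisyBit, hpoint]
  rfl

theorem computesWithin_modeProgram (hN : 2 ≤ N) (hε : 0 < ε) :
    ComputesWithin modeProgram ε bot D ⌊(210 : ℝ) * (n + Real.log N)⌋₊ (modeRelease ε bot D) := by
  refine ⟨fun τ => (run_modeProgram hN ε bot D τ).1, ?_⟩
  have hlaw := (measurePreserving_releaseDraw bot D hN hε).comp
    (measurePreserving_readTape (bits N))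
  simp only [(run_modeProgram hN ε bot D _).2, decode_noisyBit_eq_releaseDraw]
  rw [← hlaw.map_eq, Measure.map_map (measurable_of_finite _) hlaw.measurable]
  rfl

end Law

end ModeRelease

open ModeRelease in
theorem theorem7_general :
    (∀ (N : ℕ) [NeZero N] (n : ℕ) (ε : ℝ) (bot : Fin N), 2 ≤ N → 0 < ε →
      IsDP ε 0 (fun D : Fin n → Fin N => modeRelease ε bot D)) ∧
    (∃ (P : List Instr) (C : ℝ), ∀ (N : ℕ) [NeZero N] (n : ℕ) (ε : ℝ) (bot : Fin N)
      (D : Fin n → Fin N), 2 ≤ N → 0 < ε →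
      ComputesWithin P ε bot D ⌊C * (n + Real.log N)⌋₊ (modeRelease ε bot D)) ∧
    (∃ K : ℝ, ∀ ε₀ c : ℝ, 1 < c → ∃ C : ℝ, ∀ (N : ℕ) [NeZero N] (n : ℕ) (ε : ℝ)
      (bot : Fin N) (D : Fin n → Fin N), 2 ≤ N → 0 < ε → ε ≤ ε₀ → c * ε ≤ Real.log N →
      C * (Real.log N * Real.log (Real.log N / ε) / ε) < (occ₁ D : ℝ) - occ₂ D →
      1 - K / N ≤ (modeRelease ε bot D).real {mode D}) :=
  ⟨fun _ _ _ _ bot hN hε => isDP_modeRelease hN hε bot,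
    ⟨modeProgram, 210, fun _ _ _ _ bot D hN hε => computesWithin_modeProgram bot D hN hε⟩,
    ⟨2 + Real.exp 8, fun ε₀ c hc => ⟨utilityConst ε₀ c, fun _ _ _ _ bot _ hN hε hε₀ hcε hgap =>
      one_sub_le_modeRelease_mode hN hε bot
        (le_mul_half_of_utilityConst_mul_le hN hc hε hε₀ hcε hgap.le)⟩⟩⟩

open ModeRelease in
theorem theorem7 :
    (∀ (N : ℕ) [NeZero N] (n : ℕ) (ε : ℝ) (bot : Fin N), 2 ≤ N → 0 < ε →
      IsDP (2 * ε) 0 (fun D : Fin n → Fin N => modeRelease ε bot D)) ∧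
    (∃ (P : List Instr) (C : ℝ), ∀ (N : ℕ) [NeZero N] (n : ℕ) (ε : ℝ) (bot : Fin N)
      (D : Fin n → Fin N), 2 ≤ N → 0 < ε →
      ComputesWithin P ε bot D ⌊C * (n + Real.log N)⌋₊ (modeRelease ε bot D)) ∧
    (∃ K : ℝ, ∀ ε₀ c : ℝ, 0 < ε₀ → 1 < c → ∃ C : ℝ, ∀ (N : ℕ) [NeZero N] (n : ℕ) (ε : ℝ)
      (bot : Fin N) (D : Fin n → Fin N), 2 ≤ N → 0 < ε → ε ≤ ε₀ → c * ε ≤ Real.log N →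
      C * (Real.log N * Real.log (Real.log N / ε) / ε) < (occ₁ D : ℝ) - occ₂ D →
      1 - K / N ≤ (modeRelease ε bot D).real {mode D}) := by
  obtain ⟨hdp, hprogram, K, hutility⟩ := theorem7_general
  exact ⟨fun N _ n ε bot hN hε => (hdp N n ε bot hN hε).mono (by linarith), hprogram, K,
    fun ε₀ c _ hc => hutility ε₀ c hc⟩
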